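/- Let $q$ be a prime power, let $1\le s\le t$ and $0=u_0<u_1<\dots<u_s<u_{s+1}=k$ be integers. Let $S$ be a $k\times\frac{q^k-1}{q-1}$ matrix over $\mathbb F_q$ any two columns of which are linearly independent (a generator matrix of the simplex code; such a matrix exists). Let $U_i\subseteq\mathbb F_q^k$ be the span of the first $u_i$ standard basis vectors, let $S\setminus G_i$ be the matrix obtained from $S$ by deleting all columns that lie in $U_i$, and let $C=\{yG : y\in\mathbb F_q^k\}$ be the code generated by $$G=[\,S\setminus G_1,\ \dots,\ S\setminus G_s,\ \underbrace{S,\dots,S}_{t-s}\,].$$ Then $C$ is an $[n,k,d]_q$ linear code (length $n$, dimension $k$, minimum Hamming distance $d$) with $$n=t\frac{q^k-1}{q-1}-\sum_{i=1}^s\frac{q^{u_i}-1}{q-1},\qquad d=tq^{k-1}-\sum_{i=1}^s q^{u_i-1}.$$ For a subspace $U\subseteq C$ let $w(U)$ be the number of coordinates at which some word of $U$ is nonzero. For $1\le r\le k$ let $d_r(C)$ be the minimum of $w(U)$, and for $1\le j\le n$ let $A^r_j(C)$ be the number of those $U$ with $w(U)=j$, where $U$ runs over the $r$-dimensional subspaces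 of $C$. For integers $0\le b\le a$ put $\binom{a}{b}_q=\prod_{i=0}^{b-1}\frac{q^a-q^i}{q^b-q^i}$. Then: (a) $C$ has exactly one word of weight $0$; for each $0\le j\le s$ it has exactly $q^{k-u_j}-q^{k-u_{j+1}}$ words of weight $d+\sum_{i=1}^{j}q^{u_i-1}$; and it has no word of any other weight. In particular exactly $s+1$ nonzero weights occur. (b) $C$ is a Griesmer code, that is, $n=\sum_{i=0}^{k-1}\lceil d/q^i\rceil$. (c) For $1\le r\le k$, with $j_r=\max\{0\le i\le s : u_i\le r\}$, $$d_r(C)=t\frac{q^k-q^{k-r}}{q-1}-\sum_{i=1}^s\frac{q^{u_i}-1}{q-1}+\sum_{i=j_r+1}^s\frac{q^{u_i-r}-1}{q-1}.$$ (d) For $1\le r\le k$ and $1\le j\le n$, $$A^r_j(C)=\sum_{(v_1,\dots,v_{s+1})\in Z_{r,j}}\ \prod_{i=1}^{s+1}q^{(u_{i-1}-v_{i-1})(v_i-v_{i-1})}\binom{u_i-u_{i-1}}{v_i-v_{i-1}}_q ,$$ where $v_0=0$ and $Z_{r,j}$ is the set of all $(v_1,\dots,v_{s+1})\in\mathbb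 Z^{s+1}$ with $v_{s+1}=k-r$ such that $0\le v_i-v_{i-1}\le u_i-u_{i-1}$ and $\max\{0,u_i-r\}\le v_i\le\min\{u_i,k-r\}$ for $1\le i\le s$, and $$\sum_{i=1}^s\frac{q^{v_i}-1}{q-1}=j-t\frac{q^k-q^{k-r}}{q-1}+\sum_{i=1}^s\frac{q^{u_i}-1}{q-1}.$$ -/

import Mathlib

namespace LinCode

/-- The support of a set `X` of words of length `n`: the coordinates at which some word of `X`
does not vanish. -/
def supp {F : Type*} [Zero F] {n : ℕ} (X : Set (Fin n → F)) : Set (Fin n) :=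
  {i | ∃ x ∈ X, x i ≠ 0}

/-- The subcode support weight `w(X) = |supp(X)|`. -/
noncomputable def supportWeight {F : Type*} [Zero F] {n : ℕ} (X : Set (Fin n → F)) : ℕ :=
  (supp X).ncard

/-- The minimum Hamming distance of a code with at least two words. -/
noncomputable def minDist {F : Type*} [Field F] [DecidableEq F] {n : ℕ}
    (C : Submodule F (Fin n → F)) : ℕ :=
  sInf {w | ∃ x ∈ C, ∃ y ∈ C, x ≠ y ∧ hammingDist x y = w}

/-- `A_w(C)`, the number of codewords of Hamming weight `w`. -/
noncomputable def weightCount {F : Type*} [Field F] [DecidableEq F] {n : ℕ}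
    (C : Submodule F (Fin n → F)) (w : ℕ) : ℕ :=
  {c : Fin n → F | c ∈ C ∧ hammingNorm c = w}.ncard

/-- The `r`-th generalized Hamming weight `d_r(C)`, for `1 ≤ r ≤ dim C`. -/
noncomputable def ghw {F : Type*} [Field F] {n : ℕ}
    (C : Submodule F (Fin n → F)) (r : ℕ) : ℕ :=
  sInf {w | ∃ U : Submodule F (Fin n → F),
    U ≤ C ∧ Module.finrank F U = r ∧ supportWeight (U : Set (Fin n → F)) = w}

/-- `A_j^r(C)`, the number of `r`-dimensional subspaces of `C` of support weight `j`. -/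
noncomputable def subcodeCount {F : Type*} [Field F] {n : ℕ}
    (C : Submodule F (Fin n → F)) (r j : ℕ) : ℕ :=
  {U : Submodule F (Fin n → F) |
    U ≤ C ∧ Module.finrank F U = r ∧ supportWeight (U : Set (Fin n → F)) = j}.ncard

/-- The `r`-Griesmer defect
`δ_r(C) = n - d_r(C) - ∑_{i=1}^{k-r} ⌈(q-1) d_r(C) / (q^i (q^r - 1))⌉`, where `k = dim C`. -/
noncomputable def griesmerDefect {F : Type*} [Field F] [Fintype F] {n : ℕ}
    (C : Submodule F (Fin n → F)) (r : ℕ) : ℤ :=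
  (n : ℤ) - (ghw C r : ℤ) -
    ∑ i ∈ Finset.Icc 1 (Module.finrank F C - r),
      ⌈(((Fintype.card F : ℚ) - 1) * (ghw C r : ℚ)) /
        ((Fintype.card F : ℚ) ^ i * ((Fintype.card F : ℚ) ^ r - 1))⌉

/-- `C` is an `r`-Griesmer code: `r` is the least `j` with `1 ≤ j ≤ dim C` and `δ_j(C) = 0`. -/
def IsRGriesmer {F : Type*} [Field F] [Fintype F] {n : ℕ}
    (C : Submodule F (Fin n → F)) (r : ℕ) : Prop :=
  IsLeast {j | 1 ≤ j ∧ j ≤ Module.finrank F C ∧ griesmerDefect C j = 0} r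

/-- A Griesmer code is a `1`-Griesmer code. -/
def IsGriesmer {F : Type*} [Field F] [Fintype F] {n : ℕ}
    (C : Submodule F (Fin n → F)) : Prop :=
  IsRGriesmer C 1

/-- The code `{y G : y ∈ F^k}` generated by the rows of a `k × n` matrix `G`. -/
def rowCode {F : Type*} [Field F] {k n : ℕ} (G : Matrix (Fin k) (Fin n) F) :
    Submodule F (Fin n → F) :=
  LinearMap.range G.vecMulLinear

/-- `S` is a `k × (q^k - 1)/(q - 1)` matrix any two columns of which are linearly independent,
that is, for `k ≥ 2`, a generator matrix of the simplex code. -/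
def IsSimplexGenerator {F : Type*} [Field F] [Fintype F] {k m : ℕ}
    (S : Matrix (Fin k) (Fin m) F) : Prop :=
  m = (Fintype.card F ^ k - 1) / (Fintype.card F - 1) ∧
    ∀ a b : Fin m, a ≠ b → LinearIndependent F ![S.col a, S.col b]

/-- The span of the first `m` standard basis vectors of `F^k`. -/
def coordSubspace (F : Type*) [Field F] (k m : ℕ) : Submodule F (Fin k → F) :=
  Submodule.span F {x | ∃ j : Fin k, (j : ℕ) < m ∧ x = Pi.single j 1}

/-- The columns of `[S∖G_1, …, S∖G_s, S, …, S]` (`t` blocks, of which the last `t - s` are equal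
to `S`): a pair of a block number `i` and a column `c` of `S`, which in the first `s` blocks must
not lie in the coordinate subspace of dimension `u_i`.  Blocks are counted from `0` here, so that
block `i` belongs to `u (i + 1)`. -/
def ColumnIndex {F : Type*} [Field F] {k m : ℕ}
    (S : Matrix (Fin k) (Fin m) F) (u : ℕ → ℕ) (s t : ℕ) : Type :=
  {p : Fin t × Fin m // (p.1 : ℕ) < s → S.col p.2 ∉ coordSubspace F k (u ((p.1 : ℕ) + 1))}

/-- `G` is the matrix `[S∖G_1, …, S∖G_s, S, …, S]`, its columns being listed in some order. -/
def IsPuncturedCopies {F : Type*} [Field F] {k m n : ℕ}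
    (S : Matrix (Fin k) (Fin m) F) (u : ℕ → ℕ) (s t : ℕ)
    (G : Matrix (Fin k) (Fin n) F) : Prop :=
  ∃ e : Fin n ≃ ColumnIndex S u s t, ∀ j : Fin n, G.col j = S.col (e j).1.2

/-- The Gaussian binomial coefficient
`(q^a - 1)(q^a - q)⋯(q^a - q^{b-1}) / ((q^b - 1)(q^b - q)⋯(q^b - q^{b-1}))`; for `b > a` the
numerator contains the factor `q^a - q^a`, so that the value is `0`. -/
def gaussBinom (q a b : ℕ) : ℚ :=
  (∏ i ∈ Finset.range b, ((q : ℚ) ^ a - (q : ℚ) ^ i)) /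
    ∏ i ∈ Finset.range b, ((q : ℚ) ^ b - (q : ℚ) ^ i)

/-- The set `Z(q, m)` of admissible tuples `(v_0, v_1, …, v_{s+1})` with `v_0 = 0` and
`v_{s+1} = k - r`.  All entries of such a tuple lie between `0` and `k`, so the finite box over
which it is taken is no restriction. -/
def admissible (q k r s : ℕ) (u : ℕ → ℕ) (m : ℚ) : Finset (Fin (s + 2) → ℕ) :=
  (Fintype.piFinset fun _ : Fin (s + 2) => Finset.range (k + 1)).filter fun v =>
    v 0 = 0 ∧ (v (Fin.last (s + 1)) : ℤ) = (k : ℤ) - (r : ℤ) ∧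
    (∀ i : Fin (s + 1), (i : ℕ) < s →
      0 ≤ (v i.succ : ℤ) - (v i.castSucc : ℤ) ∧
      (v i.succ : ℤ) - (v i.castSucc : ℤ) ≤ (u ((i : ℕ) + 1) : ℤ) - (u i : ℤ)) ∧
    (∀ i : Fin (s + 2), 1 ≤ (i : ℕ) → (i : ℕ) ≤ s →
      max 0 ((u i : ℤ) - (r : ℤ)) ≤ (v i : ℤ) ∧
      (v i : ℤ) ≤ min (u i : ℤ) ((k : ℤ) - (r : ℤ))) ∧
    m = ∑ i : Fin (s + 2),
      if 1 ≤ (i : ℕ) ∧ (i : ℕ) ≤ s then ((q : ℚ) ^ v i - 1) / ((q : ℚ) - 1) else 0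

/-- `∏_{i=1}^{s+1} q^{(u_{i-1} - v_{i-1})(v_i - v_{i-1})} [u_i - u_{i-1}, v_i - v_{i-1}]_q`.
It is used for admissible tuples only, for which no natural subtraction here truncates. -/
def tupleTerm (q s : ℕ) (u : ℕ → ℕ) (v : Fin (s + 2) → ℕ) : ℚ :=
  ∏ i : Fin (s + 1),
    (q : ℚ) ^ ((u i - v i.castSucc) * (v i.succ - v i.castSucc)) *
      gaussBinom q (u ((i : ℕ) + 1) - u i) (v i.succ - v i.castSucc)

end LinCode

/-! A word `yG` vanishes at a coordinate exactly when the column there is orthogonal to `y`. As `y ↦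
yG` is injective (nonzero messages have positive weight), the r-dimensional subcodes correspond to
the r-dimensional `W ⊆ F^k`. The support weight is the number of columns of `G` outside `V = W^⊥`, a
space of dimension `k - r` (`subcodes_eq_image`).

Since `k ≥ 2`, the simplex generator has one column on each line of `F^k`, so a-dimensional
subspaces contain `(q^a - 1)/(q - 1)` of its columns. Adding up the blocks, the number of columns of
`G` outside `V` times `q - 1` is `t(q^k - q^(dim V)) - ∑ (q^(u_i) - q^(dim(V ∩ U_i)))`
(`card_columns_punctured_notMem`). Every weight thus depends only on the dimensions of `V` and of
the `V ∩ U_i`.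

For a single word, `V = y^⊥` is a hyperplane that contains `U_i` iff the first `u_i` entries of `y`
vanish; the weight is determined by where the first nonzero entry lies relative to the flag. For
generalized weights, `dim(V ∩ U_i) ≥ max(0, u_i - r)`, with equality for all `i` at once when `V =
U_r^⊥` (`sInf_card_columns_punctured_notMem`). The Griesmer property follows because the terms
`q^(u_i - 1)` with `u_i ≤ a` sum to less than `q^a`, so that `⌈d/q^a⌉` is explicit
(`ceil_designed_distance_div`) and its sum over `a` is geometric.

For the support weight distribution, the `V` with prescribed dimensions of all `V ∩ U_i` are counted
by climbing the flag: `card_subspaces_inf_eq` counts the extensions at one step, and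
`card_subspaces_flag` multiplies these counts. -/

namespace LinCode

/-! ### Counting subspaces by their position relative to a flag -/

section Counting

theorem linearIndependent_mkQ_iff {F : Type*} [Field F] {E : Type*} [AddCommGroup E] [Module F E]
    {b : ℕ} (A : Submodule F E) (x : Fin b → E) :
    LinearIndependent F (A.mkQ ∘ x) ↔
      LinearIndependent F x ∧ Disjoint (Submodule.span F (Set.range x)) A := by
  constructor
  · intro h
    have hx : LinearIndependent F x := LinearIndependent.of_comp A.mkQ h
    refine ⟨hx, ?_⟩
    simpa using Submodule.range_ker_disjoint h
  · rintro ⟨h1, h2⟩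
    exact h1.map (by simpa using h2)

variable {F : Type*} [Field F] [Fintype F] {E : Type*} [AddCommGroup E] [Module F E] [Finite E]

/-- No bound on `b` is needed: beyond the dimension both sides are `0`, the product through its
factor at `i = dim E`. -/
theorem cast_card_linearIndependent (b : ℕ) :
    (Nat.card {x : Fin b → E // LinearIndependent F x} : ℚ) =
      ∏ i ∈ Finset.range b,
        ((Fintype.card F : ℚ) ^ Module.finrank F E - (Fintype.card F : ℚ) ^ i) := by
  rcases le_or_gt b (Module.finrank F E) with h | h
  · rw [card_linearIndependent h, Finset.prod_range]
    push_cast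
    refine Finset.prod_congr rfl fun i _ => ?_
    rw [Nat.cast_sub (Nat.pow_le_pow_right Fintype.card_pos (by omega))]
    push_cast
    rfl
  · rw [Finset.prod_eq_zero (Finset.mem_range.2 h) (sub_self _)]
    have : IsEmpty {x : Fin b → E // LinearIndependent F x} :=
      ⟨fun x => by simpa using (x.2.fintype_card_le_finrank.trans_lt h).ne⟩
    simp

/-- The number of `b`-tuples of vectors that are linearly independent modulo `A`. -/
theorem card_linearIndependent_mkQ (A : Submodule F E) (b : ℕ) :
    (Nat.card {x : Fin b → E // LinearIndependent F (A.mkQ ∘ x)} : ℚ) =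
      (Fintype.card F : ℚ) ^ (Module.finrank F A * b) * ∏ i ∈ Finset.range b,
        ((Fintype.card F : ℚ) ^ (Module.finrank F E - Module.finrank F A) -
          (Fintype.card F : ℚ) ^ i) := by
  -- A retraction `p` onto `A` splits `E` as `(E ⧸ A) × A`. A tuple independent modulo `A` is then
  -- an independent tuple of the quotient together with arbitrary components in `A`.
  obtain ⟨p, hp⟩ := LinearMap.exists_leftInverse_of_injective A.subtype (by simp)
  have hp' : ∀ a : A, p a = a := fun a => LinearMap.congr_fun hp a
  have hinj : Function.Injective (A.mkQ.prod p) := by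
    rw [← LinearMap.ker_eq_bot, LinearMap.ker_eq_bot']
    intro v hv
    have h1 : A.mkQ v = 0 := congrArg Prod.fst hv
    have h2 : p v = 0 := congrArg Prod.snd hv
    have h3 : v ∈ A := by simpa using h1
    have h4 := hp' ⟨v, h3⟩
    rw [h2] at h4
    exact (congrArg Subtype.val h4).symm
  have hsurj : Function.Surjective (A.mkQ.prod p) := by
    rintro ⟨w, a⟩
    obtain ⟨w, rfl⟩ := A.mkQ_surjective w
    refine ⟨w - p w + a, Prod.ext ?_ ?_⟩
    · change A.mkQ (w - p w + a) = A.mkQ w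
      rw [Submodule.mkQ_apply, Submodule.mkQ_apply, Submodule.Quotient.eq,
        show w - p w + a - w = -(p w : E) + a by abel]
      exact A.add_mem (A.neg_mem (p w).2) a.2
    · simp [hp']
  let e : E ≃ (E ⧸ A) × A := Equiv.ofBijective _ ⟨hinj, hsurj⟩
  let f : {x : Fin b → E // LinearIndependent F (A.mkQ ∘ x)} ≃
      {x : Fin b → E ⧸ A // LinearIndependent F x} × (Fin b → A) :=
    { toFun := fun x => (⟨A.mkQ ∘ x.1, x.2⟩, fun i => p (x.1 i))
      invFun := fun y => ⟨fun i => e.symm (y.1.1 i, y.2 i), by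
        have : A.mkQ ∘ (fun i => e.symm (y.1.1 i, y.2 i)) = y.1.1 := by
          funext i
          exact congrArg Prod.fst (e.apply_symm_apply (y.1.1 i, y.2 i))
        rw [this]
        exact y.1.2⟩
      left_inv := fun x => Subtype.ext (funext fun i => e.symm_apply_apply (x.1 i))
      right_inv := fun y => by
        refine Prod.ext (Subtype.ext (funext fun i => ?_)) (funext fun i => ?_)
        · exact congrArg Prod.fst (e.apply_symm_apply (y.1.1 i, y.2 i))
        · exact congrArg Prod.snd (e.apply_symm_apply (y.1.1 i, y.2 i)) }
  have hA : Nat.card (Fin b → A) = Fintype.card F ^ (Module.finrank F A * b) := by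
    rw [Nat.card_fun, Module.natCard_eq_pow_finrank (K := F) (V := A), pow_mul]
    simp
  have : Finite (E ⧸ A) := Finite.of_surjective _ A.mkQ_surjective
  have hQ : Module.finrank F (E ⧸ A) = Module.finrank F E - Module.finrank F A := by
    have := A.finrank_quotient_add_finrank
    omega
  rw [Nat.card_congr f, Nat.card_prod, Nat.cast_mul, cast_card_linearIndependent, hA, hQ, mul_comm]
  push_cast
  rfl

/-- `W / (W ∩ A)` embeds in `E / A`, so for vectors of `W` independence modulo `A` is independence
modulo `W ∩ A`, and the preceding count applies inside `W`. -/
theorem card_linearIndependent_mkQ_of_mem (W A : Submodule F E) (b : ℕ) :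
    (Nat.card {x : Fin b → E // (∀ i, x i ∈ W) ∧ LinearIndependent F (A.mkQ ∘ x)} : ℚ) =
      (Fintype.card F : ℚ) ^ (Module.finrank F ↥(W ⊓ A) * b) * ∏ i ∈ Finset.range b,
        ((Fintype.card F : ℚ) ^ (Module.finrank F W - Module.finrank F ↥(W ⊓ A)) -
          (Fintype.card F : ℚ) ^ i) := by
  have hr : Module.finrank F (A.comap W.subtype) = Module.finrank F ↥(W ⊓ A) := by
    rw [← Submodule.map_comap_subtype]
    exact (LinearEquiv.finrank_eq (Submodule.equivMapOfInjective _ W.subtype_injective _))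
  have hli : ∀ x : Fin b → W, LinearIndependent F ((A.comap W.subtype).mkQ ∘ x) ↔
      LinearIndependent F (A.mkQ ∘ (fun i => (x i : E))) := by
    intro x
    have hk : LinearMap.ker ((A.comap W.subtype).mapQ A W.subtype le_rfl) = ⊥ := by
      rw [Submodule.mapQ, Submodule.ker_liftQ_eq_bot]
      intro y hy
      simpa using hy
    rw [← LinearMap.linearIndependent_iff _ hk]
    rfl
  let f : {x : Fin b → E // (∀ i, x i ∈ W) ∧ LinearIndependent F (A.mkQ ∘ x)} ≃
      {x : Fin b → W // LinearIndependent F ((A.comap W.subtype).mkQ ∘ x)} :=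
    { toFun := fun x => ⟨fun i => ⟨x.1 i, x.2.1 i⟩, (hli _).2 x.2.2⟩
      invFun := fun x => ⟨fun i => x.1 i, fun i => (x.1 i).2, (hli _).1 x.2⟩
      left_inv := fun x => rfl
      right_inv := fun x => rfl }
  rw [Nat.card_congr f, card_linearIndependent_mkQ, hr]

/-- The number of subspaces of `W` that meet `A` in the given subspace `V'` and whose dimension
exceeds that of `V'` by `b`. -/
theorem card_subspaces_inf_eq {W A V' : Submodule F E} (hAW : A ≤ W) (hV : V' ≤ A) (b : ℕ) :
    (Nat.card {V : Submodule F E // V ≤ W ∧ V ⊓ A = V' ∧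
        Module.finrank F V = Module.finrank F V' + b} : ℚ) =
      (Fintype.card F : ℚ) ^ ((Module.finrank F A - Module.finrank F V') * b) *
        gaussBinom (Fintype.card F) (Module.finrank F W - Module.finrank F A) b := by
  set q := Fintype.card F with hq
  have hq1 : 1 < q := Fintype.one_lt_card
  let P : Submodule F E → Prop := fun V => V ≤ W ∧ V ⊓ A = V' ∧
        Module.finrank F V = Module.finrank F V' + b
  let T := {x : Fin b → E // (∀ i, x i ∈ W) ∧ LinearIndependent F (A.mkQ ∘ x)}
  -- Double counting: a tuple in `W` independent modulo `A` determines the one `V = V' + span x`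
  -- that contains it, and every `V` arises from equally many tuples.
  let φ : (Σ V : {V // P V}, {x : Fin b → E // (∀ i, x i ∈ V.1) ∧
      LinearIndependent F (A.mkQ ∘ x)}) → T :=
    fun z => ⟨z.2.1, fun i => z.1.2.1 (z.2.2.1 i), z.2.2.2⟩
  have key : ∀ x : Fin b → E, LinearIndependent F (A.mkQ ∘ x) →
      (V' ⊔ Submodule.span F (Set.range x)) ⊓ A = V' ∧
      Module.finrank F ↥(V' ⊔ Submodule.span F (Set.range x)) = Module.finrank F V' + b := by
    intro x hx
    obtain ⟨h1, h2⟩ := (linearIndependent_mkQ_iff A x).1 hx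
    refine ⟨?_, ?_⟩
    -- The modular law applies because `V' ≤ A`.
    · rw [sup_inf_assoc_of_le _ hV, h2.eq_bot, sup_bot_eq]
    · have := Submodule.finrank_sup_add_finrank_inf_eq V' (Submodule.span F (Set.range x))
      rw [(h2.symm.mono_left hV).eq_bot, finrank_bot, finrank_span_eq_card h1] at this
      simpa using this
  have uniq : ∀ (V : Submodule F E) (x : Fin b → E), P V → (∀ i, x i ∈ V) →
      LinearIndependent F (A.mkQ ∘ x) → V = V' ⊔ Submodule.span F (Set.range x) := by
    intro V x hPV hx hli
    refine (Submodule.eq_of_le_of_finrank_eq (sup_le ?_ ?_) ?_).symm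
    · rw [← hPV.2.1]; exact inf_le_left
    · rw [Submodule.span_le]; rintro _ ⟨i, rfl⟩; exact hx i
    · rw [(key x hli).2, hPV.2.2]
  have hφ : Function.Bijective φ := by
    constructor
    · rintro ⟨⟨V₁, h₁⟩, ⟨x₁, hx₁⟩⟩ ⟨⟨V₂, h₂⟩, ⟨x₂, hx₂⟩⟩ h
      have hx : x₁ = x₂ := congrArg Subtype.val h
      subst hx
      have : V₁ = V₂ := (uniq V₁ x₁ h₁ hx₁.1 hx₁.2).trans (uniq V₂ x₁ h₂ hx₂.1 hx₂.2).symm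
      subst this
      rfl
    · rintro ⟨x, hx, hli⟩
      refine ⟨⟨⟨V' ⊔ Submodule.span F (Set.range x), ⟨?_, (key x hli).1, (key x hli).2⟩⟩,
        ⟨x, fun i => ?_, hli⟩⟩, rfl⟩
      · refine sup_le (hV.trans hAW) ?_
        rw [Submodule.span_le]; rintro _ ⟨i, rfl⟩; exact hx i
      · exact Submodule.mem_sup_right (Submodule.subset_span ⟨i, rfl⟩)
  have hcard := Nat.card_congr (Equiv.ofBijective φ hφ)
  have := Fintype.ofFinite {V // P V}
  rw [Nat.card_sigma] at hcard
  have hfib : ∀ V : {V // P V}, (Nat.card {x : Fin b → E // (∀ i, x i ∈ V.1) ∧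
      LinearIndependent F (A.mkQ ∘ x)} : ℚ) = (q : ℚ) ^ (Module.finrank F V' * b) *
        ∏ i ∈ Finset.range b, ((q : ℚ) ^ b - (q : ℚ) ^ i) := by
    intro V
    rw [card_linearIndependent_mkQ_of_mem, V.2.2.1, V.2.2.2, Nat.add_sub_cancel_left]
  have hT : (Nat.card T : ℚ) = _ := card_linearIndependent_mkQ_of_mem W A b
  rw [← hcard, Nat.cast_sum, Finset.sum_congr rfl fun V _ => hfib V, Finset.sum_const,
    nsmul_eq_mul, inf_eq_right.2 hAW, Finset.card_univ, ← Nat.card_eq_fintype_card] at hT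
  have hprod : ∏ i ∈ Finset.range b, ((q : ℚ) ^ b - (q : ℚ) ^ i) ≠ 0 := by
    refine Finset.prod_ne_zero_iff.2 fun i hi => ?_
    have : (q : ℚ) ^ i < (q : ℚ) ^ b :=
      pow_lt_pow_right₀ (by exact_mod_cast hq1) (Finset.mem_range.1 hi)
    exact (sub_pos.2 this).ne'
  have hq0 : (q : ℚ) ≠ 0 := by positivity
  have hle : Module.finrank F V' ≤ Module.finrank F A := Submodule.finrank_mono hV
  have hpow : (q : ℚ) ^ (Module.finrank F A * b) = (q : ℚ) ^ (Module.finrank F V' * b) *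
      (q : ℚ) ^ ((Module.finrank F A - Module.finrank F V') * b) := by
    rw [← pow_add, ← add_mul, Nat.add_sub_cancel' hle]
  rw [hpow] at hT
  have h0 : (q : ℚ) ^ (Module.finrank F V' * b) ≠ 0 := pow_ne_zero _ hq0
  change (Nat.card {V // P V} : ℚ) = _
  rw [gaussBinom, ← mul_div_assoc, eq_div_iff hprod]
  refine mul_left_cancel₀ h0 ?_
  linear_combination hT

/-- The number of subspaces that meet the members of a flag in given dimensions. -/
theorem card_subspaces_flag (U : ℕ → Submodule F E) (hU : Monotone U) (hU0 : U 0 = ⊥)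
    (v : ℕ → ℕ) (hv0 : v 0 = 0) (l : ℕ) (hv : ∀ i < l, v i ≤ v (i + 1)) :
    (Nat.card {V : Submodule F E // V ≤ U l ∧ ∀ i ≤ l, Module.finrank F ↥(V ⊓ U i) = v i} : ℚ) =
      ∏ i ∈ Finset.range l,
        (Fintype.card F : ℚ) ^ ((Module.finrank F (U i) - v i) * (v (i + 1) - v i)) *
          gaussBinom (Fintype.card F) (Module.finrank F (U (i + 1)) - Module.finrank F (U i))
            (v (i + 1) - v i) := by
  induction l with
  | zero =>
    have : Unique {V : Submodule F E // V ≤ U 0 ∧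
        ∀ i ≤ 0, Module.finrank F ↥(V ⊓ U i) = v i} :=
      { default := ⟨⊥, bot_le, fun i hi => by
          obtain rfl := Nat.le_zero.1 hi
          rw [hv0, bot_inf_eq, finrank_bot]⟩
        uniq := fun V => Subtype.ext (le_bot_iff.1 (V.2.1.trans hU0.le)) }
    rw [Nat.card_unique, Finset.prod_range_zero, Nat.cast_one]
  | succ l ih =>
    specialize ih fun i hi => hv i (by omega)
    rw [Finset.prod_range_succ, ← ih]
    let P : Submodule F E → Prop := fun V => V ≤ U l ∧
        ∀ i ≤ l, Module.finrank F ↥(V ⊓ U i) = v i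
    -- The subspaces of `U (l + 1)` are sorted by their trace on `U l`; the number over each trace
    -- depends only on its dimension `v l`.
    let φ : {V : Submodule F E // V ≤ U (l + 1) ∧
          ∀ i ≤ l + 1, Module.finrank F ↥(V ⊓ U i) = v i} →
        Σ V' : {V // P V}, {V : Submodule F E // V ≤ U (l + 1) ∧ V ⊓ U l = V'.1 ∧
          Module.finrank F V = Module.finrank F V'.1 + (v (l + 1) - v l)} :=
      fun V => ⟨⟨V.1 ⊓ U l, inf_le_right, fun i hi => by
        rw [inf_assoc, inf_eq_right.2 (hU hi)]
        exact V.2.2 i (by omega)⟩, ⟨V.1, V.2.1, rfl, by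
          have h1 := V.2.2 l (by omega)
          have h2 := V.2.2 (l + 1) le_rfl
          rw [inf_eq_left.2 V.2.1] at h2
          have := hv l (by omega)
          dsimp only
          omega⟩⟩
    have hφ : Function.Bijective φ := by
      constructor
      · intro V₁ V₂ h
        refine Subtype.ext ?_
        exact congrArg (fun z => z.2.1) h
      · rintro ⟨⟨V', hV'⟩, ⟨V, h1, h2, h3⟩⟩
        dsimp only at h2 h3
        subst h2
        refine ⟨⟨V, h1, fun i hi => ?_⟩, rfl⟩
        rcases Nat.lt_or_ge l i with h | h
        · obtain rfl : i = l + 1 := by omega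
          have h4 := hV'.2 l le_rfl
          rw [inf_assoc, inf_idem] at h4
          have := hv l (by omega)
          rw [inf_eq_left.2 h1]
          omega
        · have := hV'.2 i h
          rwa [inf_assoc, inf_eq_right.2 (hU h)] at this
    have := Fintype.ofFinite {V // P V}
    rw [Nat.card_congr (Equiv.ofBijective φ hφ), Nat.card_sigma, Nat.cast_sum]
    change _ = (Nat.card {V // P V} : ℚ) * _
    rw [Nat.card_eq_fintype_card, ← Finset.card_univ, ← nsmul_eq_mul, ← Finset.sum_const]
    refine Finset.sum_congr rfl fun V' _ => ?_
    have hV' : Module.finrank F V'.1 = v l := by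
      have := V'.2.2 l le_rfl
      rwa [inf_eq_left.2 V'.2.1] at this
    rw [card_subspaces_inf_eq (hU (Nat.le_succ l)) V'.2.1, hV']

end Counting

/-! ### Orthogonal complements in `F^k` -/

section Perp

variable {F : Type*} [Field F] {k : ℕ}

/-- The orthogonal of a subspace of `F^k` for the standard scalar product. -/
noncomputable def dotPerp (W : Submodule F (Fin k → F)) : Submodule F (Fin k → F) :=
  (Matrix.toBilin' (1 : Matrix (Fin k) (Fin k) F)).orthogonal W

theorem mem_dotPerp {W : Submodule F (Fin k → F)} {x : Fin k → F} :
    x ∈ dotPerp W ↔ ∀ y ∈ W, y ⬝ᵥ x = 0 := by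
  simp [dotPerp, LinearMap.BilinForm.mem_orthogonal_iff, Matrix.toBilin'_apply']

theorem toBilin'_one_nondegenerate :
    (Matrix.toBilin' (1 : Matrix (Fin k) (Fin k) F)).Nondegenerate :=
  (Matrix.nondegenerate_of_det_ne_zero (by simp)).toBilin'

theorem toBilin'_one_isRefl :
    (Matrix.toBilin' (1 : Matrix (Fin k) (Fin k) F)).IsRefl := by
  intro x y h
  rw [Matrix.toBilin'_apply', Matrix.one_mulVec] at h ⊢
  rwa [dotProduct_comm]

theorem finrank_dotPerp (W : Submodule F (Fin k → F)) :
    Module.finrank F (dotPerp W) = k - Module.finrank F W := by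
  rw [dotPerp, LinearMap.BilinForm.finrank_orthogonal toBilin'_one_nondegenerate]
  simp

theorem dotPerp_dotPerp (W : Submodule F (Fin k → F)) : dotPerp (dotPerp W) = W :=
  LinearMap.BilinForm.orthogonal_orthogonal toBilin'_one_nondegenerate toBilin'_one_isRefl W

theorem mem_dotPerp_span_singleton {y x : Fin k → F} :
    x ∈ dotPerp (Submodule.span F {y}) ↔ y ⬝ᵥ x = 0 := by
  rw [mem_dotPerp]
  refine ⟨fun h => h y (Submodule.mem_span_singleton_self y), fun h z hz => ?_⟩
  obtain ⟨a, rfl⟩ := Submodule.mem_span_singleton.1 hz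
  rw [smul_dotProduct, h, smul_zero]

end Perp

/-! ### The coordinate flag -/

section CoordSubspace

variable {F : Type*} [Field F] {k : ℕ}

theorem coordSubspace_mono {a b : ℕ} (h : a ≤ b) : coordSubspace F k a ≤ coordSubspace F k b :=
  Submodule.span_mono fun _ ⟨j, hj, hx⟩ => ⟨j, hj.trans_le h, hx⟩

theorem coordSubspace_zero : coordSubspace F k 0 = ⊥ := by
  simp [coordSubspace]

theorem finrank_coordSubspace {a : ℕ} (h : a ≤ k) :
    Module.finrank F (coordSubspace F k a) = a := by
  have hset : {x : Fin k → F | ∃ j : Fin k, (j : ℕ) < a ∧ x = Pi.single j 1} =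
      Set.range (fun i : Fin a => Pi.basisFun F (Fin k) (Fin.castLE h i)) := by
    ext x
    constructor
    · rintro ⟨j, hj, rfl⟩
      exact ⟨⟨j, hj⟩, by simp⟩
    · rintro ⟨i, rfl⟩
      exact ⟨Fin.castLE h i, i.2, by simp⟩
  rw [coordSubspace, hset, finrank_span_eq_card, Fintype.card_fin]
  exact (Pi.basisFun F (Fin k)).linearIndependent.comp _ (Fin.castLE_injective h)

theorem coordSubspace_self : coordSubspace F k k = ⊤ :=
  Submodule.eq_top_of_finrank_eq (by rw [finrank_coordSubspace le_rfl]; simp)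

theorem apply_eq_zero_of_mem_coordSubspace {a : ℕ} {x : Fin k → F}
    (hx : x ∈ coordSubspace F k a) (l : Fin k) (hl : a ≤ l) : x l = 0 := by
  have : coordSubspace F k a ≤ LinearMap.ker (LinearMap.proj (R := F) (φ := fun _ => F) l) := by
    rw [coordSubspace, Submodule.span_le]
    rintro _ ⟨j, hj, rfl⟩
    have : l ≠ j := by rintro rfl; omega
    simp [this]
  exact this hx

theorem mem_dotPerp_coordSubspace {a : ℕ} {y : Fin k → F} :
    y ∈ dotPerp (coordSubspace F k a) ↔ ∀ l : Fin k, (l : ℕ) < a → y l = 0 := by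
  rw [mem_dotPerp]
  constructor
  · intro h l hl
    simpa using h (Pi.single l 1) (Submodule.subset_span ⟨l, hl, rfl⟩)
  · intro h z hz
    refine Finset.sum_eq_zero fun l _ => ?_
    rcases lt_or_ge (l : ℕ) a with hl | hl
    · rw [h l hl, mul_zero]
    · rw [apply_eq_zero_of_mem_coordSubspace hz l hl, zero_mul]

/-- The orthogonal of `U_r` is a complement of `U_r`, hence for `a ≥ r` it cuts out a complement of
`U_r` in `U_a`, and for `a ≤ r` it meets `U_a` trivially. It is the extremal space for the
generalized weights. -/
theorem finrank_dotPerp_coordSubspace_inf {a r : ℕ} (ha : a ≤ k) (hr : r ≤ k) :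
    Module.finrank F ↥(dotPerp (coordSubspace F k r) ⊓ coordSubspace F k a) = a - r := by
  have hbot : dotPerp (coordSubspace F k r) ⊓ coordSubspace F k r = ⊥ := by
    rw [eq_bot_iff]
    rintro x ⟨h1, h2⟩
    refine funext fun l => ?_
    rcases lt_or_ge (l : ℕ) r with hl | hl
    · exact mem_dotPerp_coordSubspace.1 h1 l hl
    · exact apply_eq_zero_of_mem_coordSubspace h2 l hl
  rcases le_total a r with h | h
  · rw [eq_bot_iff.2 ((inf_le_inf_left _ (coordSubspace_mono h)).trans hbot.le), finrank_bot]
    omega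
  · have h1 := Submodule.finrank_sup_add_finrank_inf_eq
      (dotPerp (coordSubspace F k r)) (coordSubspace F k a)
    have h2 := Submodule.finrank_sup_add_finrank_inf_eq
      (dotPerp (coordSubspace F k r) ⊓ coordSubspace F k a) (coordSubspace F k r)
    rw [inf_assoc, inf_eq_right.2 (coordSubspace_mono h), hbot, finrank_bot,
      finrank_coordSubspace hr] at h2
    rw [finrank_dotPerp, finrank_coordSubspace hr, finrank_coordSubspace ha] at h1
    have h3 := Submodule.finrank_le (dotPerp (coordSubspace F k r) ⊔ coordSubspace F k a)
    have h4 := Submodule.finrank_mono (R := F)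
      (sup_le (inf_le_right (a := dotPerp (coordSubspace F k r))) (coordSubspace_mono (F := F)
        (k := k) h))
    rw [finrank_coordSubspace ha] at h4
    rw [Module.finrank_fin_fun] at h3
    omega

end CoordSubspace

/-! ### Columns of simplex generator matrices and of punctured copies -/

section Columns

variable {F : Type*} [Field F] [Fintype F] {k m n : ℕ}

theorem one_lt_of_isSimplexGenerator {S : Matrix (Fin k) (Fin m) F} (hk : 2 ≤ k)
    (hS : IsSimplexGenerator S) : 1 < m := by
  have hq : 1 < Fintype.card F := Fintype.one_lt_card
  rw [hS.1, Nat.lt_iff_add_one_le, Nat.le_div_iff_mul_le (by omega)]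
  have h1 : Fintype.card F ^ 2 ≤ Fintype.card F ^ k := Nat.pow_le_pow_right (by omega) hk
  have : (1 + 1) * (Fintype.card F - 1) + 1 ≤ Fintype.card F ^ 2 := by
    obtain ⟨a, ha⟩ : ∃ a, Fintype.card F = a + 1 := ⟨Fintype.card F - 1, by omega⟩
    rw [ha, Nat.add_sub_cancel]
    nlinarith
  omega

/-- A column is nonzero because it is independent of some other column; this is where `k ≥ 2`
enters, since for `k = 1` the only column might be zero. -/
theorem col_ne_zero_of_isSimplexGenerator {S : Matrix (Fin k) (Fin m) F} (hk : 2 ≤ k)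
    (hS : IsSimplexGenerator S) (c : Fin m) : S.col c ≠ 0 := by
  have : Nontrivial (Fin m) := Fin.nontrivial_iff_two_le.2 (one_lt_of_isSimplexGenerator hk hS)
  obtain ⟨b, hb⟩ := exists_ne c
  exact (hS.2 c b hb.symm).ne_zero 0

theorem mul_card_sub_one_of_isSimplexGenerator {S : Matrix (Fin k) (Fin m) F}
    (hS : IsSimplexGenerator S) : m * (Fintype.card F - 1) = Fintype.card F ^ k - 1 := by
  rw [hS.1]
  refine Nat.div_mul_cancel ?_
  simpa using Nat.sub_dvd_pow_sub_pow (Fintype.card F) 1 k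

/-- A subspace `V` contains `(q ^ dim V - 1) / (q - 1)` columns of a generator matrix of the
simplex code. -/
theorem card_columns_mem {S : Matrix (Fin k) (Fin m) F} (hk : 2 ≤ k)
    (hS : IsSimplexGenerator S) (V : Submodule F (Fin k → F)) :
    (Nat.card {c : Fin m // S.col c ∈ V} : ℚ) * ((Fintype.card F : ℚ) - 1) =
      (Fintype.card F : ℚ) ^ Module.finrank F V - 1 := by
  classical
  have hne := col_ne_zero_of_isSimplexGenerator hk hS
  -- Nonzero multiples of columns run once through all nonzero vectors: injectivity is pairwise
  -- independence, and surjectivity then follows from `m (q - 1) = q^k - 1`.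
  let ψ : Fin m × Fˣ → {x : Fin k → F // x ≠ 0} := fun p =>
    ⟨(p.2 : F) • S.col p.1, smul_ne_zero p.2.ne_zero (hne p.1)⟩
  have hinj : Function.Injective ψ := by
    rintro ⟨a, x⟩ ⟨b, y⟩ h
    have h' : (x : F) • S.col a = (y : F) • S.col b := congrArg Subtype.val h
    have hab : a = b := by
      by_contra hab
      have := LinearIndependent.pair_iff.1 (hS.2 a b hab) x (-y) (by rw [h', neg_smul, add_neg_cancel])
      exact x.ne_zero this.1
    subst hab
    rw [Units.ext (smul_left_injective F (hne a) h')]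
  have hsurj : Function.Surjective ψ := by
    refine ((Fintype.bijective_iff_injective_and_card ψ).2 ⟨hinj, ?_⟩).2
    rw [Fintype.card_prod, Fintype.card_fin, Fintype.card_units,
      mul_card_sub_one_of_isSimplexGenerator hS]
    simp
  -- The restriction of `ψ` to `V`: a nonzero multiple lies in `V` iff the column does.
  let χ : {c : Fin m // S.col c ∈ V} × Fˣ → {x : V // x ≠ 0} := fun p =>
    ⟨⟨(p.2 : F) • S.col p.1.1, V.smul_mem _ p.1.2⟩, fun h =>
      (ψ (p.1.1, p.2)).2 (congrArg Subtype.val h)⟩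
  have hχ : Function.Bijective χ := by
    constructor
    · rintro ⟨a, x⟩ ⟨b, y⟩ h
      have := @hinj (a.1, x) (b.1, y) (Subtype.ext (congrArg (fun z => z.1.1) h))
      rw [Prod.mk.injEq] at this
      exact Prod.ext (Subtype.ext this.1) this.2
    · rintro ⟨⟨x, hx⟩, hx0⟩
      obtain ⟨⟨c, y⟩, hcy⟩ := hsurj ⟨x, fun h => hx0 (Subtype.ext h)⟩
      have hcy' : (y : F) • S.col c = x := congrArg Subtype.val hcy
      refine ⟨(⟨c, ?_⟩, y), Subtype.ext (Subtype.ext hcy')⟩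
      rw [← hcy', ← Units.smul_def, Submodule.smul_mem_iff'] at hx
      exact hx
  have h := Nat.card_congr (Equiv.ofBijective χ hχ)
  have h2 : Nat.card {x : V // x ≠ 0} + 1 = Fintype.card F ^ Module.finrank F V := by
    rw [Nat.card_eq_fintype_card, Fintype.card_subtype_compl, Fintype.card_subtype_eq,
      Module.card_eq_pow_finrank (K := F) (V := V)]
    exact Nat.sub_add_cancel (Nat.one_le_pow _ _ Fintype.card_pos)
  have h3 : Nat.card Fˣ + 1 = Fintype.card F := by
    rw [Nat.card_eq_fintype_card, Fintype.card_units]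
    exact Nat.sub_add_cancel Fintype.card_pos
  rw [← h, Nat.card_prod] at h2
  have h2' : (Nat.card {c : Fin m // S.col c ∈ V} : ℚ) * (Nat.card Fˣ : ℚ) + 1 =
      (Fintype.card F : ℚ) ^ Module.finrank F V := by exact_mod_cast h2
  have h3' : (Nat.card Fˣ : ℚ) + 1 = Fintype.card F := by exact_mod_cast h3
  rw [← h2', ← h3']
  ring

theorem card_columns_notMem {S : Matrix (Fin k) (Fin m) F} (hk : 2 ≤ k)
    (hS : IsSimplexGenerator S) (V : Submodule F (Fin k → F)) :
    (Nat.card {c : Fin m // S.col c ∉ V} : ℚ) * ((Fintype.card F : ℚ) - 1) =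
      (Fintype.card F : ℚ) ^ k - (Fintype.card F : ℚ) ^ Module.finrank F V := by
  classical
  have h1 := card_columns_mem hk hS V
  have h2 := card_columns_mem hk hS ⊤
  rw [finrank_top, Module.finrank_fin_fun] at h2
  have h3 : Nat.card {c : Fin m // S.col c ∈ V} + Nat.card {c : Fin m // S.col c ∉ V} =
      Nat.card {c : Fin m // S.col c ∈ (⊤ : Submodule F (Fin k → F))} := by
    simp only [Nat.card_eq_fintype_card, Fintype.card_subtype]
    rw [Finset.card_filter_add_card_filter_not]
    simp
  rw [← h3] at h2
  push_cast at h2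
  linear_combination h2 - h1

theorem card_columns_notMem_notMem {S : Matrix (Fin k) (Fin m) F} (hk : 2 ≤ k)
    (hS : IsSimplexGenerator S) (U V : Submodule F (Fin k → F)) :
    (Nat.card {c : Fin m // S.col c ∉ U ∧ S.col c ∉ V} : ℚ) * ((Fintype.card F : ℚ) - 1) =
      (Fintype.card F : ℚ) ^ k - (Fintype.card F : ℚ) ^ Module.finrank F V -
        ((Fintype.card F : ℚ) ^ Module.finrank F U -
          (Fintype.card F : ℚ) ^ Module.finrank F ↥(V ⊓ U)) := by
  classical
  have h1 := card_columns_notMem hk hS V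
  have h2 := card_columns_mem hk hS U
  have h3 := card_columns_mem hk hS (V ⊓ U)
  -- Both sides count the columns that lie in `U` or outside `V`.
  have h4 : Nat.card {c : Fin m // S.col c ∉ U ∧ S.col c ∉ V} +
      Nat.card {c : Fin m // S.col c ∈ U} =
      Nat.card {c : Fin m // S.col c ∉ V} + Nat.card {c : Fin m // S.col c ∈ V ⊓ U} := by
    simp only [Nat.card_eq_fintype_card, Fintype.card_subtype]
    rw [← Finset.card_union_of_disjoint, ← Finset.card_union_of_disjoint]
    · congr 1
      ext c
      simp only [Finset.mem_union, Finset.mem_filter, Finset.mem_univ, true_and,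
        Submodule.mem_inf]
      tauto
    · rw [Finset.disjoint_filter]
      exact fun c _ h h' => h h'.1
    · rw [Finset.disjoint_filter]
      exact fun c _ h h' => h.1 h'
  have h4' : (Nat.card {c : Fin m // S.col c ∉ U ∧ S.col c ∉ V} : ℚ) +
      Nat.card {c : Fin m // S.col c ∈ U} =
      Nat.card {c : Fin m // S.col c ∉ V} + Nat.card {c : Fin m // S.col c ∈ V ⊓ U} := by
    exact_mod_cast h4
  linear_combination ((Fintype.card F : ℚ) - 1) * h4' + h1 - h2 + h3

theorem sum_Icc_one_eq_sum_range {M : Type*} [AddCommMonoid M] (f : ℕ → M) (s : ℕ) :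
    ∑ i ∈ Finset.Icc 1 s, f i = ∑ i ∈ Finset.range s, f (i + 1) := by
  induction s with
  | zero => simp
  | succ s ih => rw [Finset.sum_Icc_succ_top (by omega), Finset.sum_range_succ, ih]

/-- The number of columns of `[S∖G_1, …, S∖G_s, S, …, S]` outside a subspace. -/
theorem card_columns_punctured_notMem {S : Matrix (Fin k) (Fin m) F} (hk : 2 ≤ k)
    (hS : IsSimplexGenerator S) {u : ℕ → ℕ} {s t : ℕ} (hst : s ≤ t) (hu : ∀ i ≤ s, u i ≤ k)
    {G : Matrix (Fin k) (Fin n) F} (hG : IsPuncturedCopies S u s t G)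
    (V : Submodule F (Fin k → F)) :
    (Nat.card {j : Fin n // G.col j ∉ V} : ℚ) * ((Fintype.card F : ℚ) - 1) =
      t * ((Fintype.card F : ℚ) ^ k - (Fintype.card F : ℚ) ^ Module.finrank F V) -
        ∑ i ∈ Finset.Icc 1 s, ((Fintype.card F : ℚ) ^ u i -
          (Fintype.card F : ℚ) ^ Module.finrank F ↥(V ⊓ coordSubspace F k (u i))) := by
  obtain ⟨e, he⟩ := hG
  let f : {j : Fin n // G.col j ∉ V} ≃ {p : ColumnIndex S u s t // S.col p.1.2 ∉ V} :=
    e.subtypeEquiv fun j => by rw [he j]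
  let g : {p : ColumnIndex S u s t // S.col p.1.2 ∉ V} ≃
      Σ i : Fin t, {c : Fin m // ((i : ℕ) < s → S.col c ∉ coordSubspace F k (u (i + 1))) ∧
        S.col c ∉ V} :=
    { toFun := fun p => ⟨p.1.1.1, p.1.1.2, p.1.2, p.2⟩
      invFun := fun p => ⟨⟨(p.1, p.2.1), p.2.2.1⟩, p.2.2.2⟩
      left_inv := fun _ => rfl
      right_inv := fun _ => rfl }
  rw [Nat.card_congr (f.trans g), Nat.card_sigma, Nat.cast_sum, Finset.sum_mul]
  have hterm : ∀ i : Fin t, (Nat.card {c : Fin m //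
      ((i : ℕ) < s → S.col c ∉ coordSubspace F k (u (i + 1))) ∧ S.col c ∉ V} : ℚ) *
        ((Fintype.card F : ℚ) - 1) =
      ((Fintype.card F : ℚ) ^ k - (Fintype.card F : ℚ) ^ Module.finrank F V) -
        if (i : ℕ) < s then ((Fintype.card F : ℚ) ^ u (i + 1) -
          (Fintype.card F : ℚ) ^ Module.finrank F ↥(V ⊓ coordSubspace F k (u (i + 1)))) else 0 := by
    intro i
    split_ifs with hi
    · simp only [hi, true_imp_iff]
      rw [card_columns_notMem_notMem hk hS, finrank_coordSubspace (hu _ (by omega))]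
    · simp only [hi, false_imp_iff, true_and, sub_zero]
      exact card_columns_notMem hk hS V
  rw [Finset.sum_congr rfl fun i _ => hterm i, Finset.sum_sub_distrib, Finset.sum_const,
    Finset.card_univ, Fintype.card_fin, nsmul_eq_mul, sum_Icc_one_eq_sum_range,
    ← Finset.sum_range (fun i => if i < s then ((Fintype.card F : ℚ) ^ u (i + 1) -
      (Fintype.card F : ℚ) ^ Module.finrank F ↥(V ⊓ coordSubspace F k (u (i + 1)))) else 0),
    ← Finset.sum_filter]
  congr 2
  ext i
  simp only [Finset.mem_filter, Finset.mem_range]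
  omega

/-- One representative of each point of the projective space serves as a column. -/
theorem exists_isSimplexGenerator (F : Type*) [Field F] [Fintype F] (k : ℕ) :
    ∃ (m : ℕ) (S : Matrix (Fin k) (Fin m) F), IsSimplexGenerator S := by
  classical
  have := Fintype.ofFinite (Projectivization F (Fin k → F))
  let e := Fintype.equivFin (Projectivization F (Fin k → F))
  refine ⟨Fintype.card (Projectivization F (Fin k → F)),
    Matrix.of fun i j => (e.symm j).rep i, ?_, fun a b hab => ?_⟩
  · rw [← Nat.card_eq_fintype_card, Projectivization.card'']
    simp
  · have := (Projectivization.independent_pair_iff_ne (e.symm a) (e.symm b)).2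
      (fun h => hab (e.symm.injective h))
    rw [Projectivization.independent_iff] at this
    have hfun : ![(e.symm a).rep, (e.symm b).rep] =
        Projectivization.rep ∘ ![e.symm a, e.symm b] := by
      funext i
      fin_cases i <;> rfl
    rw [← hfun] at this
    exact this

end Columns

theorem exists_isPuncturedCopies {F : Type*} [Field F] {k m : ℕ}
    (S : Matrix (Fin k) (Fin m) F) (u : ℕ → ℕ) (s t : ℕ) :
    ∃ (n : ℕ) (G : Matrix (Fin k) (Fin n) F), IsPuncturedCopies S u s t G := by
  have : Finite (ColumnIndex S u s t) := Subtype.finite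
  obtain ⟨n, ⟨e⟩⟩ := Finite.exists_equiv_fin (ColumnIndex S u s t)
  exact ⟨n, Matrix.of fun i j => S i (e.symm j).1.2, e.symm, fun _ => rfl⟩

/-! ### Sums of powers along the flag -/

section Sums

variable {u : ℕ → ℕ} {s : ℕ}

theorem le_of_flag (hu : ∀ i ≤ s, u i < u (i + 1)) {i j : ℕ} (hij : i ≤ j) (hj : j ≤ s + 1) :
    u i ≤ u j := by
  induction j, hij using Nat.le_induction with
  | base => exact le_rfl
  | succ j _ ih => exact (ih (by omega)).trans (hu j (by omega)).le

theorem pos_of_flag (hu : ∀ i ≤ s, u i < u (i + 1)) {i : ℕ} (h1 : 1 ≤ i) (hi : i ≤ s + 1) :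
    1 ≤ u i := by
  obtain ⟨i, rfl⟩ : ∃ a, i = a + 1 := ⟨i - 1, by omega⟩
  have := hu i (by omega)
  omega

/-- The exponents are distinct and below `u j`, so the sum is a number with at most `u j` base-`q`
digits, all `0` or `1`. -/
theorem sum_pow_lt_pow (hu : ∀ i ≤ s, u i < u (i + 1)) {q : ℕ} (hq : 2 ≤ q) {j : ℕ}
    (hj : j ≤ s + 1) : ∑ i ∈ Finset.Icc 1 j, q ^ (u i - 1) < q ^ u j := by
  induction j with
  | zero => simpa using Nat.pow_pos (by omega)
  | succ j ih =>
    rw [Finset.sum_Icc_succ_top (by omega)]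
    have h1 := ih (by omega)
    have h2 := hu j (by omega)
    have h3 : q ^ u j ≤ q ^ (u (j + 1) - 1) := Nat.pow_le_pow_right (by omega) (by omega)
    have h4 : q ^ u (j + 1) = q ^ (u (j + 1) - 1) * q := by
      rw [← pow_succ]; congr 1; omega
    have h5 : q ^ (u (j + 1) - 1) * 2 ≤ q ^ (u (j + 1) - 1) * q := Nat.mul_le_mul_left _ hq
    omega

/-- These are the digits below position `a`, that is, the remainder of the full sum modulo `q ^ a`.
-/
theorem sum_filter_pow_lt_pow (hu : ∀ i ≤ s, u i < u (i + 1)) {q : ℕ} (hq : 2 ≤ q) (a : ℕ)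
    {j : ℕ} (hj : j ≤ s + 1) :
    ∑ i ∈ Finset.Icc 1 j, (if a < u i then 0 else q ^ (u i - 1)) < q ^ a := by
  induction j with
  | zero => simpa using Nat.pow_pos (by omega)
  | succ j ih =>
    by_cases h : a < u (j + 1)
    · rw [Finset.sum_Icc_succ_top (by omega), if_pos h]
      exact ih (by omega)
    · refine lt_of_le_of_lt (Finset.sum_le_sum fun i _ => ?_)
        ((sum_pow_lt_pow hu hq hj).trans_le (Nat.pow_le_pow_right (by omega) (not_lt.1 h)))
      split_ifs <;> simp

end Sums

/-! ### From words and subcodes to subspaces of `F^k` -/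

section Code

variable {F : Type*} [Field F] {k n : ℕ}

theorem supportWeight_map_vecMulLinear (G : Matrix (Fin k) (Fin n) F)
    (W : Submodule F (Fin k → F)) :
    supportWeight ((W.map G.vecMulLinear : Submodule F (Fin n → F)) : Set (Fin n → F)) =
      Nat.card {j : Fin n // G.col j ∉ dotPerp W} := by
  rw [supportWeight, ← Nat.card_coe_set_eq]
  refine Nat.card_congr (Equiv.setCongr (Set.ext fun j => ?_))
  simp only [supp, Set.mem_ofPred_eq, mem_dotPerp]
  constructor
  · rintro ⟨_, ⟨y, hy, rfl⟩, h⟩ h'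
    exact h (h' y hy)
  · intro h
    by_contra hc
    exact h fun y hy => by_contra fun h0 => hc ⟨_, ⟨y, hy, rfl⟩, h0⟩

theorem hammingNorm_vecMul [DecidableEq F] (G : Matrix (Fin k) (Fin n) F) (y : Fin k → F) :
    hammingNorm (G.vecMulLinear y) =
      Nat.card {j : Fin n // G.col j ∉ dotPerp (Submodule.span F {y})} := by
  classical
  rw [hammingNorm, Nat.card_eq_fintype_card, Fintype.card_subtype]
  congr 1
  ext j
  simp only [Finset.mem_filter, Finset.mem_univ, true_and, mem_dotPerp_span_singleton]
  rfl

/-- Every subcode is the image of a unique `W`, and `V` is the orthogonal of `W`. Counting and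
minimizing over subcodes thereby become problems about subspaces of `F^k` of dimension `k - r`. -/
theorem subcodes_eq_image {G : Matrix (Fin k) (Fin n) F}
    (hG : Function.Injective G.vecMulLinear) {r : ℕ} (hr : r ≤ k) (w : ℕ) :
    {U : Submodule F (Fin n → F) | U ≤ rowCode G ∧ Module.finrank F U = r ∧
        supportWeight (U : Set (Fin n → F)) = w} =
      (fun V => (dotPerp V).map G.vecMulLinear) '' {V : Submodule F (Fin k → F) |
        Module.finrank F V = k - r ∧ Nat.card {j : Fin n // G.col j ∉ V} = w} := by
  have hfr : ∀ W : Submodule F (Fin k → F),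
      Module.finrank F (W.map G.vecMulLinear) = Module.finrank F W := fun W =>
    (LinearEquiv.finrank_eq (Submodule.equivMapOfInjective _ hG W)).symm
  ext U
  constructor
  · rintro ⟨h1, h2, h3⟩
    obtain ⟨W, rfl⟩ : ∃ W : Submodule F (Fin k → F), W.map G.vecMulLinear = U :=
      ⟨U.comap G.vecMulLinear, Submodule.map_comap_eq_of_le h1⟩
    rw [hfr] at h2
    refine ⟨dotPerp W, ⟨by rw [finrank_dotPerp, h2], ?_⟩, ?_⟩
    · rw [← h3, supportWeight_map_vecMulLinear]
    · simp only [dotPerp_dotPerp]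
  · rintro ⟨V, ⟨h1, h2⟩, rfl⟩
    refine ⟨LinearMap.map_le_range, ?_, ?_⟩
    · rw [hfr, finrank_dotPerp, h1]
      omega
    · rw [supportWeight_map_vecMulLinear, dotPerp_dotPerp, h2]

theorem subcodeCount_rowCode {G : Matrix (Fin k) (Fin n) F}
    (hG : Function.Injective G.vecMulLinear) {r : ℕ} (hr : r ≤ k) (w : ℕ) :
    subcodeCount (rowCode G) r w = Nat.card {V : Submodule F (Fin k → F) //
        Module.finrank F V = k - r ∧ Nat.card {j : Fin n // G.col j ∉ V} = w} := by
  rw [subcodeCount, subcodes_eq_image hG hr, Set.ncard_image_of_injective, ← Nat.card_coe_set_eq]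
  · rfl
  · intro V₁ V₂ h
    have := Submodule.map_injective_of_injective hG h
    rw [← dotPerp_dotPerp V₁, this, dotPerp_dotPerp]

theorem ghw_rowCode {G : Matrix (Fin k) (Fin n) F}
    (hG : Function.Injective G.vecMulLinear) {r : ℕ} (hr : r ≤ k) :
    ghw (rowCode G) r = sInf {w | ∃ V : Submodule F (Fin k → F),
        Module.finrank F V = k - r ∧ Nat.card {j : Fin n // G.col j ∉ V} = w} := by
  rw [ghw]
  congr 1
  ext w
  have := congrArg Set.Nonempty (subcodes_eq_image hG hr w)
  rw [Set.image_nonempty] at this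
  exact iff_of_eq this

theorem weightCount_rowCode [DecidableEq F] {G : Matrix (Fin k) (Fin n) F}
    (hG : Function.Injective G.vecMulLinear) (w : ℕ) :
    weightCount (rowCode G) w = {y : Fin k → F | hammingNorm (G.vecMulLinear y) = w}.ncard := by
  rw [weightCount, ← Set.ncard_image_of_injective _ hG]
  congr 1
  ext c
  constructor
  · rintro ⟨⟨y, rfl⟩, h⟩
    exact ⟨y, h, rfl⟩
  · rintro ⟨y, h, rfl⟩
    exact ⟨⟨y, rfl⟩, h⟩

theorem le_finrank_inf_coordSubspace {r a : ℕ} (ha : a ≤ k) (hr : r ≤ k)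
    {V : Submodule F (Fin k → F)} (hV : Module.finrank F V = k - r) :
    a - r ≤ Module.finrank F ↥(V ⊓ coordSubspace F k a) := by
  have h1 := Submodule.finrank_sup_add_finrank_inf_eq V (coordSubspace F k a)
  have h2 := Submodule.finrank_le (V ⊔ coordSubspace F k a)
  rw [Module.finrank_fin_fun] at h2
  rw [finrank_coordSubspace ha] at h1
  omega

theorem finrank_dotPerp_span_singleton {y : Fin k → F} (hy : y ≠ 0) :
    Module.finrank F (dotPerp (Submodule.span F {y})) = k - 1 := by
  rw [finrank_dotPerp, finrank_span_singleton hy]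

/-- A hyperplane either contains `U_a` or cuts its dimension by one, and `y^⊥` contains `U_a` iff
`y` is orthogonal to the first `a` basis vectors. -/
theorem finrank_dotPerp_span_singleton_inf {y : Fin k → F} (hy : y ≠ 0) {a : ℕ} (ha : a ≤ k)
    [Decidable (∀ l : Fin k, (l : ℕ) < a → y l = 0)] :
    Module.finrank F ↥(dotPerp (Submodule.span F {y}) ⊓ coordSubspace F k a) =
      if ∀ l : Fin k, (l : ℕ) < a → y l = 0 then a else a - 1 := by
  have hiff : coordSubspace F k a ≤ dotPerp (Submodule.span F {y}) ↔
      ∀ l : Fin k, (l : ℕ) < a → y l = 0 := by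
    rw [← mem_dotPerp_coordSubspace, mem_dotPerp]
    exact forall₂_congr fun z _ => by rw [mem_dotPerp_span_singleton, dotProduct_comm]
  split_ifs with h
  · rw [inf_eq_right.2 (hiff.2 h), finrank_coordSubspace ha]
  · have h1 := Submodule.finrank_sup_add_finrank_inf_eq
      (dotPerp (Submodule.span F {y})) (coordSubspace F k a)
    have h2 := Submodule.finrank_le (dotPerp (Submodule.span F {y}) ⊔ coordSubspace F k a)
    have h3 : dotPerp (Submodule.span F {y}) <
        dotPerp (Submodule.span F {y}) ⊔ coordSubspace F k a :=
      left_lt_sup.2 fun h' => h (hiff.1 h')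
    have h4 := Submodule.finrank_lt_finrank_of_lt h3
    rw [Module.finrank_fin_fun] at h2
    rw [finrank_coordSubspace ha] at h1
    rw [finrank_dotPerp_span_singleton hy] at h1 h4
    omega

theorem card_level [Fintype F] {a b : ℕ} (hab : a ≤ b) (hb : b ≤ k) :
    ({y : Fin k → F | (∀ l : Fin k, (l : ℕ) < a → y l = 0) ∧
        ∃ l : Fin k, (l : ℕ) < b ∧ y l ≠ 0}.ncard : ℤ) =
      (Fintype.card F : ℤ) ^ (k - a) - (Fintype.card F : ℤ) ^ (k - b) := by
  have hset : {y : Fin k → F | (∀ l : Fin k, (l : ℕ) < a → y l = 0) ∧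
      ∃ l : Fin k, (l : ℕ) < b ∧ y l ≠ 0} =
      (dotPerp (coordSubspace F k a) : Set (Fin k → F)) \ dotPerp (coordSubspace F k b) := by
    ext y
    simp [mem_dotPerp_coordSubspace]
  have hcard : ∀ c ≤ k, (dotPerp (coordSubspace F k c) : Set (Fin k → F)).ncard =
      Fintype.card F ^ (k - c) := by
    intro c hc
    rw [← Nat.card_coe_set_eq]
    refine (Module.natCard_eq_pow_finrank (K := F) (V := dotPerp (coordSubspace F k c))).trans ?_
    rw [finrank_dotPerp, finrank_coordSubspace hc, Nat.card_eq_fintype_card]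
  have hsub : (dotPerp (coordSubspace F k b) : Set (Fin k → F)) ⊆
      dotPerp (coordSubspace F k a) := by
    intro y hy
    simp only [SetLike.mem_coe, mem_dotPerp_coordSubspace] at hy ⊢
    exact fun l hl => hy l (hl.trans_le hab)
  rw [hset, Set.ncard_sdiff hsub, hcard a (hab.trans hb), hcard b hb,
    Nat.cast_sub (Nat.pow_le_pow_right Fintype.card_pos (by omega))]
  push_cast
  rfl

/-- The level is the largest `j ≤ s` for which `y` vanishes before `u j`. Index `0` qualifies since
`u 0 = 0`, and for `j = s` a nonzero entry exists since `u (s + 1) = k`. -/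
theorem exists_level {s : ℕ} {u : ℕ → ℕ} (hu0 : u 0 = 0) (huk : u (s + 1) = k)
    {y : Fin k → F} (hy : y ≠ 0) :
    ∃ j ≤ s, (∀ l : Fin k, (l : ℕ) < u j → y l = 0) ∧
      ∃ l : Fin k, (l : ℕ) < u (j + 1) ∧ y l ≠ 0 := by
  classical
  let P : ℕ → Prop := fun j => ∀ l : Fin k, (l : ℕ) < u j → y l = 0
  refine ⟨Nat.findGreatest P s, Nat.findGreatest_le s, ?_, ?_⟩
  · exact Nat.findGreatest_spec (P := P) (Nat.zero_le s) (fun l hl => by omega)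
  · rcases (Nat.findGreatest_le (P := P) s).lt_or_eq with h | h
    · have := Nat.findGreatest_is_greatest (P := P) (Nat.lt_succ_self _) h
      simpa [P] using this
    · rw [h, huk]
      obtain ⟨l, hl⟩ := Function.ne_iff.1 hy
      exact ⟨l, l.2, hl⟩

theorem weightCount_zero [DecidableEq F] (C : Submodule F (Fin n → F)) : weightCount C 0 = 1 := by
  rw [weightCount, Set.ncard_eq_one]
  refine ⟨0, Set.ext fun c => ?_⟩
  simp only [Set.mem_ofPred_eq, hammingNorm_eq_zero, Set.mem_singleton_iff]
  exact ⟨fun h => h.2, fun h => ⟨h ▸ C.zero_mem, h⟩⟩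

theorem finrank_rowCode {G : Matrix (Fin k) (Fin n) F} (hG : Function.Injective G.vecMulLinear) :
    Module.finrank F (rowCode G) = k := by
  rw [rowCode, LinearMap.finrank_range_of_inj hG, Module.finrank_fin_fun]

theorem finrank_inf_coordSubspace_le_add {a b : ℕ} (hab : a ≤ b) (hb : b ≤ k)
    (V : Submodule F (Fin k → F)) :
    Module.finrank F ↥(V ⊓ coordSubspace F k b) ≤
      Module.finrank F ↥(V ⊓ coordSubspace F k a) + (b - a) := by
  have h1 := Submodule.finrank_sup_add_finrank_inf_eq (V ⊓ coordSubspace F k b)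
    (coordSubspace F k a)
  have h2 : Module.finrank F ↥(V ⊓ coordSubspace F k b ⊔ coordSubspace F k a) ≤ b := by
    exact (Submodule.finrank_mono (sup_le inf_le_right (coordSubspace_mono hab))).trans
      (finrank_coordSubspace hb).le
  rw [inf_assoc, inf_eq_right.2 (coordSubspace_mono hab), finrank_coordSubspace (hab.trans hb)] at h1
  omega

end Code

/-! ### Weights in the punctured copies -/

section Punctured

variable {F : Type*} [Field F] [Fintype F] {k m n s t : ℕ} {u : ℕ → ℕ}
  {S : Matrix (Fin k) (Fin m) F} {G : Matrix (Fin k) (Fin n) F}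

theorem length_punctured (hk : 2 ≤ k) (hS : IsSimplexGenerator S) (hst : s ≤ t)
    (hu : ∀ i ≤ s, u i ≤ k) (hG : IsPuncturedCopies S u s t G) :
    (n : ℚ) * ((Fintype.card F : ℚ) - 1) = t * ((Fintype.card F : ℚ) ^ k - 1) -
        ∑ i ∈ Finset.Icc 1 s, ((Fintype.card F : ℚ) ^ u i - 1) := by
  have h := card_columns_punctured_notMem hk hS hst hu hG ⊥
  have hcard : Nat.card {j : Fin n // G.col j ∉ (⊥ : Submodule F (Fin k → F))} = n := by
    rw [Nat.card_congr (Equiv.subtypeUnivEquiv fun j => ?_), Nat.card_fin]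
    obtain ⟨e, he⟩ := hG
    rw [he, Submodule.mem_bot]
    exact col_ne_zero_of_isSimplexGenerator hk hS _
  have hbot : ∀ i, Module.finrank F ↥((⊥ : Submodule F (Fin k → F)) ⊓
      coordSubspace F k (u i)) = 0 := fun i => by rw [bot_inf_eq, finrank_bot]
  simpa only [hcard, hbot, finrank_bot, pow_zero] using h

theorem card_sub_one_pos (F : Type*) [Field F] [Fintype F] : (0 : ℚ) < (Fintype.card F : ℚ) - 1 :=
  sub_pos.2 (by exact_mod_cast Fintype.one_lt_card)

/-- Each full copy of `S` contributes `q ^ (k - 1)`, and the removal of the columns in `U_i` costs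
`q ^ (u i - 1)` unless `U_i` lies in the hyperplane `y^⊥`. The additive form avoids truncated
subtraction. -/
theorem hammingNorm_punctured [DecidableEq F] (hk : 2 ≤ k) (hS : IsSimplexGenerator S)
    (hst : s ≤ t) (hu : ∀ i ≤ s, u i ≤ k) (hu1 : ∀ i, 1 ≤ i → i ≤ s → 1 ≤ u i)
    (hG : IsPuncturedCopies S u s t G) {y : Fin k → F} (hy : y ≠ 0) :
    hammingNorm (G.vecMulLinear y) + ∑ i ∈ Finset.Icc 1 s,
        (if ∀ l : Fin k, (l : ℕ) < u i → y l = 0 then 0 else Fintype.card F ^ (u i - 1)) =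
      t * Fintype.card F ^ (k - 1) := by
  have h := card_columns_punctured_notMem hk hS hst hu hG (dotPerp (Submodule.span F {y}))
  have hpow : ∀ a : ℕ, 1 ≤ a → (Fintype.card F : ℚ) ^ a =
      (Fintype.card F : ℚ) ^ (a - 1) * (Fintype.card F : ℚ) := by
    intro a ha
    rw [← pow_succ]; congr 1; omega
  rw [← hammingNorm_vecMul, finrank_dotPerp_span_singleton hy, hpow k (by omega)] at h
  have hsum : ∑ i ∈ Finset.Icc 1 s, ((Fintype.card F : ℚ) ^ u i - (Fintype.card F : ℚ) ^
      Module.finrank F ↥(dotPerp (Submodule.span F {y}) ⊓ coordSubspace F k (u i))) =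
      (∑ i ∈ Finset.Icc 1 s, (if ∀ l : Fin k, (l : ℕ) < u i → y l = 0 then 0 else
        (Fintype.card F : ℚ) ^ (u i - 1))) * ((Fintype.card F : ℚ) - 1) := by
    rw [Finset.sum_mul]
    refine Finset.sum_congr rfl fun i hi => ?_
    rw [Finset.mem_Icc] at hi
    rw [finrank_dotPerp_span_singleton_inf hy (hu i hi.2)]
    split_ifs
    · ring
    · rw [hpow (u i) (hu1 i hi.1 hi.2)]
      ring
  rw [hsum] at h
  have h' : (hammingNorm (G.vecMulLinear y) : ℚ) + ∑ i ∈ Finset.Icc 1 s,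
        (if ∀ l : Fin k, (l : ℕ) < u i → y l = 0 then 0 else
          (Fintype.card F : ℚ) ^ (u i - 1)) = t * (Fintype.card F : ℚ) ^ (k - 1) := by
    refine mul_right_cancel₀ (card_sub_one_pos F).ne' ?_
    linear_combination h
  exact_mod_cast h'

/-- The weight of the word of a message whose first nonzero entry lies between `u_j` and
`u_{j+1}`. -/
theorem hammingNorm_punctured_of_level [DecidableEq F] (hk : 2 ≤ k) (hS : IsSimplexGenerator S)
    (hst : s ≤ t) (hu : ∀ i ≤ s, u i < u (i + 1)) (huk : u (s + 1) = k)
    (hG : IsPuncturedCopies S u s t G) {d : ℕ}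
    (hd : d + ∑ i ∈ Finset.Icc 1 s, Fintype.card F ^ (u i - 1) = t * Fintype.card F ^ (k - 1))
    {y : Fin k → F} {j : ℕ} (hj : j ≤ s) (h1 : ∀ l : Fin k, (l : ℕ) < u j → y l = 0)
    (h2 : ∃ l : Fin k, (l : ℕ) < u (j + 1) ∧ y l ≠ 0) :
    hammingNorm (G.vecMulLinear y) = d + ∑ i ∈ Finset.Icc 1 j, Fintype.card F ^ (u i - 1) := by
  obtain ⟨l₀, hl₀, hy₀⟩ := h2
  have hy : y ≠ 0 := fun h => hy₀ (congrFun h l₀)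
  have h := hammingNorm_punctured hk hS hst
    (fun i hi => huk ▸ le_of_flag hu (i := i) (j := s + 1) (by omega) le_rfl)
    (fun i h1 hi => pos_of_flag hu h1 (by omega)) hG hy
  -- The message vanishes before `u i` exactly for `i ≤ j`, so just these terms are not subtracted
  -- from the weight.
  have hsplit : ∑ i ∈ Finset.Icc 1 s, Fintype.card F ^ (u i - 1) =
      (∑ i ∈ Finset.Icc 1 j, Fintype.card F ^ (u i - 1)) + ∑ i ∈ Finset.Icc 1 s,
        (if ∀ l : Fin k, (l : ℕ) < u i → y l = 0 then 0 else Fintype.card F ^ (u i - 1)) := by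
    have hj' : Finset.Icc 1 j = (Finset.Icc 1 s).filter (· ≤ j) := by
      ext i
      simp only [Finset.mem_Icc, Finset.mem_filter]
      omega
    rw [hj', Finset.sum_filter, ← Finset.sum_add_distrib]
    refine Finset.sum_congr rfl fun i hi => ?_
    rw [Finset.mem_Icc] at hi
    by_cases hij : i ≤ j
    · rw [if_pos hij, if_pos, add_zero]
      exact fun l hl => h1 l (hl.trans_le (le_of_flag hu hij (by omega)))
    · rw [if_neg hij, if_neg, zero_add]
      exact fun h' => hy₀ (h' l₀ (hl₀.trans_le (le_of_flag hu (by omega) (by omega))))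
  omega

/-- The number of columns outside `V` grows with each `dim(V ∩ U_i)`, and the orthogonal of `U_r`
minimizes all these dimensions simultaneously. As the minimum is attained, the value of `sInf` on
the empty set plays no role. -/
theorem sInf_card_columns_punctured_notMem (hk : 2 ≤ k) (hS : IsSimplexGenerator S)
    (hst : s ≤ t) (hu : ∀ i ≤ s, u i ≤ k) (hG : IsPuncturedCopies S u s t G)
    {r : ℕ} (hr : r ≤ k) :
    ((sInf {w | ∃ V : Submodule F (Fin k → F), Module.finrank F V = k - r ∧
        Nat.card {j : Fin n // G.col j ∉ V} = w} : ℕ) : ℚ) * ((Fintype.card F : ℚ) - 1) =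
      t * ((Fintype.card F : ℚ) ^ k - (Fintype.card F : ℚ) ^ (k - r)) -
        ∑ i ∈ Finset.Icc 1 s, ((Fintype.card F : ℚ) ^ u i -
          (Fintype.card F : ℚ) ^ (u i - r)) := by
  have hV₀ : Module.finrank F (dotPerp (coordSubspace F k r)) = k - r := by
    rw [finrank_dotPerp, finrank_coordSubspace hr]
  have hN₀ := card_columns_punctured_notMem hk hS hst hu hG (dotPerp (coordSubspace F k r))
  have hsum : ∑ i ∈ Finset.Icc 1 s, ((Fintype.card F : ℚ) ^ u i - (Fintype.card F : ℚ) ^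
      Module.finrank F ↥(dotPerp (coordSubspace F k r) ⊓ coordSubspace F k (u i))) =
      ∑ i ∈ Finset.Icc 1 s, ((Fintype.card F : ℚ) ^ u i - (Fintype.card F : ℚ) ^ (u i - r)) :=
    Finset.sum_congr rfl fun i hi => by
      rw [finrank_dotPerp_coordSubspace_inf (hu i (Finset.mem_Icc.1 hi).2) hr]
  rw [hV₀, hsum] at hN₀
  have hleast : IsLeast {w | ∃ V : Submodule F (Fin k → F), Module.finrank F V = k - r ∧
        Nat.card {j : Fin n // G.col j ∉ V} = w}
      (Nat.card {j : Fin n // G.col j ∉ dotPerp (coordSubspace F k r)}) := by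
    refine ⟨⟨_, hV₀, rfl⟩, ?_⟩
    rintro _ ⟨V, hV, rfl⟩
    have hN := card_columns_punctured_notMem hk hS hst hu hG V
    rw [hV] at hN
    have hle : ∑ i ∈ Finset.Icc 1 s, ((Fintype.card F : ℚ) ^ u i -
        (Fintype.card F : ℚ) ^ Module.finrank F ↥(V ⊓ coordSubspace F k (u i))) ≤
        ∑ i ∈ Finset.Icc 1 s, ((Fintype.card F : ℚ) ^ u i -
          (Fintype.card F : ℚ) ^ (u i - r)) := by
      refine Finset.sum_le_sum fun i hi => sub_le_sub_left ?_ _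
      refine pow_le_pow_right₀ (by exact_mod_cast Fintype.card_pos) ?_
      exact le_finrank_inf_coordSubspace (hu i (Finset.mem_Icc.1 hi).2) hr hV
    have := le_of_mul_le_mul_right (show
      (Nat.card {j : Fin n // G.col j ∉ dotPerp (coordSubspace F k r)} : ℚ) *
        ((Fintype.card F : ℚ) - 1) ≤
      (Nat.card {j : Fin n // G.col j ∉ V} : ℚ) * ((Fintype.card F : ℚ) - 1) by
        rw [hN, hN₀]; linarith) (card_sub_one_pos F)
    exact_mod_cast this
  rw [hleast.csInf_eq, hN₀]

end Punctured

/-! ### Parameters, weight distribution and the Griesmer property -/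

section Parameters

variable {F : Type*} [Field F] [Fintype F] {k m n s t : ℕ} {u : ℕ → ℕ}
  {S : Matrix (Fin k) (Fin m) F} {G : Matrix (Fin k) (Fin n) F}

/-- The subtracted sum is below `q ^ u s ≤ q ^ (k - 1)`, and `t ≥ 1`. -/
theorem exists_designed_distance (hst : s ≤ t) (hs : 1 ≤ s) (hu : ∀ i ≤ s, u i < u (i + 1))
    (huk : u (s + 1) = k) {q : ℕ} (hq : 2 ≤ q) :
    ∃ d, 0 < d ∧ d + ∑ i ∈ Finset.Icc 1 s, q ^ (u i - 1) = t * q ^ (k - 1) := by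
  have h1 := sum_pow_lt_pow hu hq (Nat.le_succ s)
  have h2 := hu s le_rfl
  have h3 : q ^ u s ≤ q ^ (k - 1) := Nat.pow_le_pow_right (by omega) (by omega)
  have h4 : 1 * q ^ (k - 1) ≤ t * q ^ (k - 1) := Nat.mul_le_mul_right _ (by omega)
  exact ⟨t * q ^ (k - 1) - ∑ i ∈ Finset.Icc 1 s, q ^ (u i - 1), by omega, by omega⟩

theorem le_of_flag_top (hu : ∀ i ≤ s, u i < u (i + 1)) (huk : u (s + 1) = k) {i : ℕ}
    (hi : i ≤ s + 1) : u i ≤ k :=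
  huk ▸ le_of_flag hu hi le_rfl

theorem two_le_of_flag (hs : 1 ≤ s) (hu : ∀ i ≤ s, u i < u (i + 1)) (huk : u (s + 1) = k) :
    2 ≤ k := by
  have h1 := pos_of_flag hu hs (Nat.le_succ s)
  have h2 := hu s le_rfl
  omega

theorem vecMulLinear_injective_punctured (hs : 1 ≤ s) (hst : s ≤ t)
    (hu0 : u 0 = 0) (hu : ∀ i ≤ s, u i < u (i + 1)) (huk : u (s + 1) = k)
    (hS : IsSimplexGenerator S) (hG : IsPuncturedCopies S u s t G) :
    Function.Injective G.vecMulLinear := by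
  classical
  rw [← LinearMap.ker_eq_bot, LinearMap.ker_eq_bot']
  intro y hy
  by_contra hy0
  obtain ⟨d, hd0, hd⟩ := exists_designed_distance hst hs hu huk (q := Fintype.card F)
    Fintype.one_lt_card
  obtain ⟨j, hj, h1, h2⟩ := exists_level hu0 huk hy0
  have h := hammingNorm_punctured_of_level (two_le_of_flag hs hu huk) hS hst hu huk hG hd hj h1 h2
  rw [hy, hammingNorm_zero] at h
  omega

theorem sum_pow_strictMono {q : ℕ} (hq : 0 < q) :
    StrictMono fun j => ∑ i ∈ Finset.Icc 1 j, q ^ (u i - 1) :=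
  strictMono_nat_of_lt_succ fun j => by
    rw [Finset.sum_Icc_succ_top (by omega)]
    exact Nat.lt_add_of_pos_right (Nat.pow_pos hq)

theorem hammingNorm_eq_iff_level [DecidableEq F] (hs : 1 ≤ s) (hst : s ≤ t)
    (hu0 : u 0 = 0) (hu : ∀ i ≤ s, u i < u (i + 1)) (huk : u (s + 1) = k)
    (hS : IsSimplexGenerator S) (hG : IsPuncturedCopies S u s t G) {d : ℕ} (hd0 : 0 < d)
    (hd : d + ∑ i ∈ Finset.Icc 1 s, Fintype.card F ^ (u i - 1) = t * Fintype.card F ^ (k - 1))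
    {j : ℕ} (hj : j ≤ s) (y : Fin k → F) :
    hammingNorm (G.vecMulLinear y) = d + ∑ i ∈ Finset.Icc 1 j, Fintype.card F ^ (u i - 1) ↔
      (∀ l : Fin k, (l : ℕ) < u j → y l = 0) ∧ ∃ l : Fin k, (l : ℕ) < u (j + 1) ∧ y l ≠ 0 := by
  have hk := two_le_of_flag hs hu huk
  constructor
  · intro h
    have hy : y ≠ 0 := by
      rintro rfl
      rw [map_zero, hammingNorm_zero] at h
      omega
    obtain ⟨j', hj', h1, h2⟩ := exists_level hu0 huk hy
    rw [hammingNorm_punctured_of_level hk hS hst hu huk hG hd hj' h1 h2] at h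
    obtain rfl : j' = j :=
      (sum_pow_strictMono (u := u) (Fintype.card_pos (α := F))).injective (Nat.add_left_cancel h)
    exact ⟨h1, h2⟩
  · rintro ⟨h1, h2⟩
    exact hammingNorm_punctured_of_level hk hS hst hu huk hG hd hj h1 h2

theorem minDist_punctured [DecidableEq F] (hs : 1 ≤ s) (hst : s ≤ t)
    (hu0 : u 0 = 0) (hu : ∀ i ≤ s, u i < u (i + 1)) (huk : u (s + 1) = k)
    (hS : IsSimplexGenerator S) (hG : IsPuncturedCopies S u s t G) {d : ℕ} (hd0 : 0 < d)
    (hd : d + ∑ i ∈ Finset.Icc 1 s, Fintype.card F ^ (u i - 1) = t * Fintype.card F ^ (k - 1)) :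
    minDist (rowCode G) = d := by
  have hk := two_le_of_flag hs hu huk
  have hleast : IsLeast {w | ∃ x ∈ rowCode G, ∃ y ∈ rowCode G, x ≠ y ∧ hammingDist x y = w} d := by
    constructor
    · have h1 := hu 0 (Nat.zero_le s)
      -- The first unit vector has level `0` because `u 1 ≥ 1`, so its word attains the least
      -- weight.
      have hw : hammingNorm (G.vecMulLinear (Pi.single ⟨0, by omega⟩ 1)) = d := by
        have := (hammingNorm_eq_iff_level hs hst hu0 hu huk hS hG hd0 hd (Nat.zero_le s)
          (Pi.single ⟨0, by omega⟩ 1)).2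
          ⟨fun l hl => by omega, ⟨0, by omega⟩, by dsimp only; omega, by simp⟩
        simpa using this
      refine ⟨_, ⟨Pi.single ⟨0, by omega⟩ 1, rfl⟩, 0, Submodule.zero_mem _, ?_, ?_⟩
      · intro h
        rw [h, hammingNorm_zero] at hw
        omega
      · rw [hammingDist_zero_right, hw]
    · rintro _ ⟨_, ⟨x, rfl⟩, _, ⟨y, rfl⟩, hxy, rfl⟩
      have hne : y - x ≠ 0 := fun h => hxy (by rw [sub_eq_zero.1 h])
      obtain ⟨j, hj, h1, h2⟩ := exists_level hu0 huk hne
      rw [hammingDist_eq_hammingNorm, neg_add_eq_sub, ← map_sub,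
        hammingNorm_punctured_of_level hk hS hst hu huk hG hd hj h1 h2]
      exact Nat.le_add_right _ _
  exact hleast.csInf_eq

theorem weightCount_punctured [DecidableEq F] (hs : 1 ≤ s) (hst : s ≤ t)
    (hu0 : u 0 = 0) (hu : ∀ i ≤ s, u i < u (i + 1)) (huk : u (s + 1) = k)
    (hS : IsSimplexGenerator S) (hG : IsPuncturedCopies S u s t G) {d : ℕ} (hd0 : 0 < d)
    (hd : d + ∑ i ∈ Finset.Icc 1 s, Fintype.card F ^ (u i - 1) = t * Fintype.card F ^ (k - 1))
    {j : ℕ} (hj : j ≤ s) :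
    (weightCount (rowCode G) (d + ∑ i ∈ Finset.Icc 1 j, Fintype.card F ^ (u i - 1)) : ℤ) =
      (Fintype.card F : ℤ) ^ (k - u j) - (Fintype.card F : ℤ) ^ (k - u (j + 1)) := by
  rw [weightCount_rowCode (vecMulLinear_injective_punctured hs hst hu0 hu huk hS hG),
    ← card_level (hu j hj).le (le_of_flag_top hu huk (by omega))]
  congr 2
  ext y
  exact hammingNorm_eq_iff_level hs hst hu0 hu huk hS hG hd0 hd hj y

theorem weightCount_punctured_eq_zero [DecidableEq F] (hs : 1 ≤ s) (hst : s ≤ t)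
    (hu0 : u 0 = 0) (hu : ∀ i ≤ s, u i < u (i + 1)) (huk : u (s + 1) = k)
    (hS : IsSimplexGenerator S) (hG : IsPuncturedCopies S u s t G) {d : ℕ}
    (hd : d + ∑ i ∈ Finset.Icc 1 s, Fintype.card F ^ (u i - 1) = t * Fintype.card F ^ (k - 1))
    {w : ℕ} (hw : w ≠ 0)
    (hw' : ∀ j ≤ s, w ≠ d + ∑ i ∈ Finset.Icc 1 j, Fintype.card F ^ (u i - 1)) :
    weightCount (rowCode G) w = 0 := by
  rw [weightCount, Set.ncard_eq_zero, Set.eq_empty_iff_forall_notMem]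
  rintro _ ⟨⟨y, rfl⟩, h⟩
  have hy : y ≠ 0 := by
    rintro rfl
    rw [map_zero, hammingNorm_zero] at h
    exact hw h.symm
  obtain ⟨j, hj, h1, h2⟩ := exists_level hu0 huk hy
  rw [hammingNorm_punctured_of_level (two_le_of_flag hs hu huk) hS hst hu huk hG hd hj h1 h2] at h
  exact hw' j hj h.symm

theorem ncard_weights_punctured [DecidableEq F] (hs : 1 ≤ s) (hst : s ≤ t)
    (hu0 : u 0 = 0) (hu : ∀ i ≤ s, u i < u (i + 1)) (huk : u (s + 1) = k)
    (hS : IsSimplexGenerator S) (hG : IsPuncturedCopies S u s t G) {d : ℕ} (hd0 : 0 < d)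
    (hd : d + ∑ i ∈ Finset.Icc 1 s, Fintype.card F ^ (u i - 1) = t * Fintype.card F ^ (k - 1)) :
    {w : ℕ | 1 ≤ w ∧ weightCount (rowCode G) w ≠ 0}.ncard = s + 1 := by
  have hset : {w : ℕ | 1 ≤ w ∧ weightCount (rowCode G) w ≠ 0} =
      ((Finset.range (s + 1)).image
        fun j => d + ∑ i ∈ Finset.Icc 1 j, Fintype.card F ^ (u i - 1) : Finset ℕ) := by
    ext w
    simp only [Set.mem_ofPred_eq, Finset.coe_image, Finset.coe_range, Set.mem_image, Set.mem_Iio]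
    constructor
    · rintro ⟨h1, h2⟩
      by_contra hc
      exact h2 (weightCount_punctured_eq_zero hs hst hu0 hu huk hS hG hd (by omega)
        fun j hj h => hc ⟨j, by omega, h.symm⟩)
    · rintro ⟨j, hj, rfl⟩
      refine ⟨by omega, fun h => ?_⟩
      have h1 := weightCount_punctured hs hst hu0 hu huk hS hG hd0 hd (j := j) (by omega)
      rw [h, Nat.cast_zero, eq_comm, sub_eq_zero] at h1
      have h2 := hu j (by omega)
      have h3 := le_of_flag_top hu huk (i := j + 1) (by omega)
      have := Nat.pow_right_injective (Fintype.one_lt_card (α := F))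
        (show Fintype.card F ^ (k - u j) = Fintype.card F ^ (k - u (j + 1)) by exact_mod_cast h1)
      omega
  rw [hset, Set.ncard_coe_finset, Finset.card_image_of_injective, Finset.card_range]
  exact fun a b h => (sum_pow_strictMono (u := u) (Fintype.card_pos (α := F))).injective
    (Nat.add_left_cancel h)

theorem ghw_punctured (hs : 1 ≤ s) (hst : s ≤ t)
    (hu0 : u 0 = 0) (hu : ∀ i ≤ s, u i < u (i + 1)) (huk : u (s + 1) = k)
    (hS : IsSimplexGenerator S) (hG : IsPuncturedCopies S u s t G) {r : ℕ} (hr : r ≤ k) :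
    (ghw (rowCode G) r : ℚ) * ((Fintype.card F : ℚ) - 1) =
      t * ((Fintype.card F : ℚ) ^ k - (Fintype.card F : ℚ) ^ (k - r)) -
        ∑ i ∈ Finset.Icc 1 s, ((Fintype.card F : ℚ) ^ u i -
          (Fintype.card F : ℚ) ^ (u i - r)) := by
  rw [ghw_rowCode (vecMulLinear_injective_punctured hs hst hu0 hu huk hS hG) hr]
  exact sInf_card_columns_punctured_notMem (two_le_of_flag hs hu huk) hS hst
    (fun i hi => le_of_flag_top hu huk (by omega)) hG hr

theorem ghw_one_punctured (hs : 1 ≤ s) (hst : s ≤ t)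
    (hu0 : u 0 = 0) (hu : ∀ i ≤ s, u i < u (i + 1)) (huk : u (s + 1) = k)
    (hS : IsSimplexGenerator S) (hG : IsPuncturedCopies S u s t G) {d : ℕ}
    (hd : d + ∑ i ∈ Finset.Icc 1 s, Fintype.card F ^ (u i - 1) = t * Fintype.card F ^ (k - 1)) :
    ghw (rowCode G) 1 = d := by
  have hk := two_le_of_flag hs hu huk
  have h := ghw_punctured hs hst hu0 hu huk hS hG (r := 1) (by omega)
  have hpow : ∀ a : ℕ, 1 ≤ a → (Fintype.card F : ℚ) ^ a - (Fintype.card F : ℚ) ^ (a - 1) =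
      (Fintype.card F : ℚ) ^ (a - 1) * ((Fintype.card F : ℚ) - 1) := by
    intro a ha
    rw [mul_sub, ← pow_succ, mul_one]; congr 2; omega
  rw [hpow k (by omega), Finset.sum_congr rfl fun i hi =>
    hpow (u i) (pos_of_flag hu (Finset.mem_Icc.1 hi).1 (by have := (Finset.mem_Icc.1 hi).2; omega)),
    ← Finset.sum_mul] at h
  have hd' : (d : ℚ) + ∑ i ∈ Finset.Icc 1 s, (Fintype.card F : ℚ) ^ (u i - 1) =
      t * (Fintype.card F : ℚ) ^ (k - 1) := by exact_mod_cast hd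
  have : (ghw (rowCode G) 1 : ℚ) = d := by
    refine mul_right_cancel₀ (card_sub_one_pos F).ne' ?_
    linear_combination h - ((Fintype.card F : ℚ) - 1) * hd'
  exact_mod_cast this

/-- Collecting the multiples of `q ^ a` gives `d = M q ^ a - R`, where `R` is the sum of the `q ^ (u
l - 1)` with `u l ≤ a`. Since `0 ≤ R < q ^ a`, the ceiling is `M`. -/
theorem ceil_designed_distance_div (hu : ∀ i ≤ s, u i < u (i + 1)) {q : ℕ} (hq : 2 ≤ q) {d : ℕ}
    (hd : d + ∑ i ∈ Finset.Icc 1 s, q ^ (u i - 1) = t * q ^ (k - 1)) {a : ℕ} (ha : a ≤ k - 1) :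
    ⌈((q : ℚ) - 1) * (d : ℚ) / ((q : ℚ) ^ a * ((q : ℚ) ^ 1 - 1))⌉ =
      t * (q : ℤ) ^ (k - 1 - a) -
        ∑ l ∈ Finset.Icc 1 s, if a < u l then (q : ℤ) ^ (u l - 1 - a) else 0 := by
  have hq1 : (0 : ℚ) < (q : ℚ) - 1 := sub_pos.2 (by exact_mod_cast hq)
  have hqa : (0 : ℚ) < (q : ℚ) ^ a := pow_pos (by linarith) a
  have hdiv : ((q : ℚ) - 1) * (d : ℚ) / ((q : ℚ) ^ a * ((q : ℚ) ^ 1 - 1)) =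
      (d : ℚ) / (q : ℚ) ^ a := by
    field_simp
  have hlt := sum_filter_pow_lt_pow hu hq a (Nat.le_succ s)
  have hsplit : ∑ i ∈ Finset.Icc 1 s, q ^ (u i - 1) =
      (∑ l ∈ Finset.Icc 1 s, if a < u l then q ^ (u l - 1 - a) else 0) * q ^ a +
        ∑ i ∈ Finset.Icc 1 s, (if a < u i then 0 else q ^ (u i - 1)) := by
    rw [Finset.sum_mul, ← Finset.sum_add_distrib]
    refine Finset.sum_congr rfl fun i _ => ?_
    split_ifs with h
    · rw [← pow_add, add_zero]; congr 1; omega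
    · simp
  have hk' : q ^ (k - 1) = q ^ (k - 1 - a) * q ^ a := by
    rw [← pow_add]; congr 1; omega
  rw [hsplit, hk'] at hd
  have hdq : (d : ℚ) + ((∑ l ∈ Finset.Icc 1 s, if a < u l then (q : ℚ) ^ (u l - 1 - a) else 0) *
      (q : ℚ) ^ a + ((∑ i ∈ Finset.Icc 1 s, (if a < u i then 0 else q ^ (u i - 1)) : ℕ) : ℚ)) =
      t * ((q : ℚ) ^ (k - 1 - a) * (q : ℚ) ^ a) := by exact_mod_cast hd
  have hltq : ((∑ i ∈ Finset.Icc 1 s, (if a < u i then 0 else q ^ (u i - 1)) : ℕ) : ℚ) <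
      (q : ℚ) ^ a := by exact_mod_cast hlt
  have h0 : (0 : ℚ) ≤ ((∑ i ∈ Finset.Icc 1 s, (if a < u i then 0 else q ^ (u i - 1)) : ℕ) : ℚ) :=
    Nat.cast_nonneg _
  rw [hdiv, Int.ceil_eq_iff, lt_div_iff₀ hqa, div_le_iff₀ hqa]
  push_cast at hdq hltq h0 ⊢
  constructor
  · linarith
  · linarith

theorem sum_range_pow_sub_mul (x : ℚ) (a : ℕ) :
    (∑ i ∈ Finset.range a, x ^ (a - 1 - i)) * (x - 1) = x ^ a - 1 := by
  rw [Finset.sum_range_reflect (fun i => x ^ i) a, geom_sum_mul]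

theorem isGriesmer_punctured (hs : 1 ≤ s) (hst : s ≤ t)
    (hu0 : u 0 = 0) (hu : ∀ i ≤ s, u i < u (i + 1)) (huk : u (s + 1) = k)
    (hS : IsSimplexGenerator S) (hG : IsPuncturedCopies S u s t G) :
    IsGriesmer (rowCode G) := by
  have hk := two_le_of_flag hs hu huk
  have hq : 2 ≤ Fintype.card F := Fintype.one_lt_card
  obtain ⟨d, hd0, hd⟩ := exists_designed_distance hst hs hu huk hq
  have hfin := finrank_rowCode (vecMulLinear_injective_punctured hs hst hu0 hu huk hS hG)
  refine ⟨⟨le_rfl, by omega, ?_⟩, fun j hj => hj.1⟩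
  rw [griesmerDefect, hfin, ghw_one_punctured hs hst hu0 hu huk hS hG hd]
  let f : ℕ → ℤ := fun a => t * (Fintype.card F : ℤ) ^ (k - 1 - a) -
    ∑ l ∈ Finset.Icc 1 s, if a < u l then (Fintype.card F : ℤ) ^ (u l - 1 - a) else 0
  have hsum : ∑ i ∈ Finset.Icc 1 (k - 1), ⌈((Fintype.card F : ℚ) - 1) * (d : ℚ) /
      ((Fintype.card F : ℚ) ^ i * ((Fintype.card F : ℚ) ^ 1 - 1))⌉ =
      ∑ i ∈ Finset.Icc 1 (k - 1), f i :=
    Finset.sum_congr rfl fun i hi =>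
      ceil_designed_distance_div hu hq hd (Finset.mem_Icc.1 hi).2
  -- The sum in the defect starts at `i = 1`; the separate term `d` is the missing summand at `0`.
  have hf0 : f 0 = d := by
    have hd' : (d : ℤ) + ∑ i ∈ Finset.Icc 1 s, (Fintype.card F : ℤ) ^ (u i - 1) =
      t * (Fintype.card F : ℤ) ^ (k - 1) := by exact_mod_cast hd
    have : ∑ l ∈ Finset.Icc 1 s, (if 0 < u l then (Fintype.card F : ℤ) ^ (u l - 1 - 0) else 0) =
        ∑ i ∈ Finset.Icc 1 s, (Fintype.card F : ℤ) ^ (u i - 1) :=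
      Finset.sum_congr rfl fun i hi => by
        rw [Finset.mem_Icc] at hi
        rw [if_pos (show 0 < u i from pos_of_flag hu hi.1 (by omega)), Nat.sub_zero]
    simp only [f]
    rw [this, Nat.sub_zero]
    linarith
  have hrange : (d : ℤ) + ∑ i ∈ Finset.Icc 1 (k - 1), f i = ∑ i ∈ Finset.range k, f i := by
    obtain ⟨k', rfl⟩ : ∃ k', k = k' + 1 := ⟨k - 1, by omega⟩
    rw [Finset.sum_range_succ', hf0, Nat.add_sub_cancel, sum_Icc_one_eq_sum_range, add_comm]
  have hn : (n : ℤ) = ∑ i ∈ Finset.range k, f i := by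
    have hlen := length_punctured hk hS hst (fun i hi => le_of_flag_top hu huk (by omega)) hG
    have : (n : ℚ) = ∑ i ∈ Finset.range k, (f i : ℚ) := by
      refine mul_right_cancel₀ (card_sub_one_pos F).ne' ?_
      rw [hlen]
      simp only [f]
      push_cast
      -- After exchanging the sums, each `l` contributes a geometric series over `i < u l`, which
      -- times `q - 1` is `q ^ u l - 1`.
      rw [Finset.sum_sub_distrib (s := Finset.range k), ← Finset.mul_sum, sub_mul, mul_assoc, sum_range_pow_sub_mul,
        Finset.sum_comm, Finset.sum_mul]
      congr 1
      refine Finset.sum_congr rfl fun l hl => ?_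
      have hl' := le_of_flag_top hu huk (i := l) (by have := (Finset.mem_Icc.1 hl).2; omega)
      rw [← sum_range_pow_sub_mul, ← Finset.sum_filter]
      congr 2
      ext i
      simp only [Finset.mem_filter, Finset.mem_range]
      omega
    exact_mod_cast this
  rw [hsum, hn]
  linarith

end Parameters

/-! ### Support weight distributions of subcodes -/

section SubcodeCount

variable {F : Type*} [Field F] [Fintype F] {k m n s t : ℕ} {u : ℕ → ℕ}
  {S : Matrix (Fin k) (Fin m) F} {G : Matrix (Fin k) (Fin n) F}

theorem sum_fin_ite_eq_sum_Icc {M : Type*} [AddCommMonoid M] (s : ℕ) (f : Fin (s + 2) → M)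
    (g : ℕ → M) (hfg : ∀ i : Fin (s + 2), f i = g i) :
    ∑ i : Fin (s + 2), (if 1 ≤ (i : ℕ) ∧ (i : ℕ) ≤ s then f i else 0) =
      ∑ i ∈ Finset.Icc 1 s, g i := by
  simp only [hfg]
  rw [← Finset.sum_range (fun i => if 1 ≤ i ∧ i ≤ s then g i else 0), ← Finset.sum_filter]
  congr 1
  ext i
  simp only [Finset.mem_filter, Finset.mem_range, Finset.mem_Icc]
  omega

/-- Outside a subspace of codimension `r` there are `j` columns if and only if the dimensions of
its intersections with the flag satisfy the condition on admissible tuples. -/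
theorem card_columns_punctured_notMem_eq_iff (hk : 2 ≤ k) (hS : IsSimplexGenerator S)
    (hst : s ≤ t) (hu : ∀ i ≤ s, u i ≤ k) (hG : IsPuncturedCopies S u s t G)
    {V : Submodule F (Fin k → F)} {a : ℕ} (hV : Module.finrank F V = a) (j : ℕ) :
    Nat.card {j : Fin n // G.col j ∉ V} = j ↔
      (j : ℚ) - t * (((Fintype.card F : ℚ) ^ k - (Fintype.card F : ℚ) ^ a) /
          ((Fintype.card F : ℚ) - 1)) +
        ∑ i ∈ Finset.Icc 1 s, ((Fintype.card F : ℚ) ^ u i - 1) / ((Fintype.card F : ℚ) - 1) =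
      ∑ i ∈ Finset.Icc 1 s, ((Fintype.card F : ℚ) ^
        Module.finrank F ↥(V ⊓ coordSubspace F k (u i)) - 1) / ((Fintype.card F : ℚ) - 1) := by
  have h := card_columns_punctured_notMem hk hS hst hu hG V
  have hq := (card_sub_one_pos F).ne'
  rw [hV] at h
  have hN : (Nat.card {j : Fin n // G.col j ∉ V} : ℚ) -
      t * (((Fintype.card F : ℚ) ^ k - (Fintype.card F : ℚ) ^ a) / ((Fintype.card F : ℚ) - 1)) +
        ∑ i ∈ Finset.Icc 1 s, ((Fintype.card F : ℚ) ^ u i - 1) / ((Fintype.card F : ℚ) - 1) =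
      ∑ i ∈ Finset.Icc 1 s, ((Fintype.card F : ℚ) ^
        Module.finrank F ↥(V ⊓ coordSubspace F k (u i)) - 1) / ((Fintype.card F : ℚ) - 1) := by
    rw [eq_div_of_mul_eq hq h, ← sub_eq_zero, add_sub_assoc, ← Finset.sum_sub_distrib]
    have : ∀ i, ((Fintype.card F : ℚ) ^ u i - 1) / ((Fintype.card F : ℚ) - 1) -
        ((Fintype.card F : ℚ) ^ Module.finrank F ↥(V ⊓ coordSubspace F k (u i)) - 1) /
          ((Fintype.card F : ℚ) - 1) =
        ((Fintype.card F : ℚ) ^ u i -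
          (Fintype.card F : ℚ) ^ Module.finrank F ↥(V ⊓ coordSubspace F k (u i))) /
          ((Fintype.card F : ℚ) - 1) := fun i => by ring
    rw [Finset.sum_congr rfl fun i _ => this i, ← Finset.sum_div]
    ring
  rw [← hN, add_left_inj, sub_left_inj, eq_comm]
  exact Nat.cast_inj.symm

/-- The dimensions of the intersections of a subspace with the flag. -/
noncomputable def flagDims (u : ℕ → ℕ) (s : ℕ) (V : Submodule F (Fin k → F)) (i : Fin (s + 2)) :
    ℕ :=
  Module.finrank F ↥(V ⊓ coordSubspace F k (u i))

theorem flagDims_mem_admissible (hu0 : u 0 = 0) (hu : ∀ i ≤ s, u i < u (i + 1))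
    (huk : u (s + 1) = k) {r : ℕ} (hr : r ≤ k) {V : Submodule F (Fin k → F)}
    (hV : Module.finrank F V = k - r) {c : ℚ}
    (hc : c = ∑ i ∈ Finset.Icc 1 s, ((Fintype.card F : ℚ) ^
        Module.finrank F ↥(V ⊓ coordSubspace F k (u i)) - 1) / ((Fintype.card F : ℚ) - 1)) :
    flagDims u s V ∈ admissible (Fintype.card F) k r s u c := by
  have hmono : ∀ i : Fin (s + 2), u i ≤ k := fun i => le_of_flag_top hu huk (by omega)
  have hleV : ∀ i, flagDims u s V i ≤ k - r := fun i => hV ▸ Submodule.finrank_mono inf_le_left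
  have hleu : ∀ i, flagDims u s V i ≤ u i := fun i =>
    (Submodule.finrank_mono inf_le_right).trans (finrank_coordSubspace (hmono i)).le
  rw [admissible, Finset.mem_filter, Fintype.mem_piFinset]
  refine ⟨fun i => ?_, ?_, ?_, fun i hi => ?_, fun i h1 h2 => ?_, ?_⟩
  · rw [Finset.mem_range]
    have := hleV i
    omega
  · have := hleu 0
    rw [Fin.val_zero, hu0] at this
    omega
  · have : flagDims u s V (Fin.last (s + 1)) = k - r := by
      rw [flagDims, Fin.val_last, huk, coordSubspace_self, inf_top_eq, hV]
    rw [this]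
    omega
  · have hlt := hu i (by omega)
    have h1 : flagDims u s V i.castSucc ≤ flagDims u s V i.succ :=
      Submodule.finrank_mono (inf_le_inf_left _ (coordSubspace_mono hlt.le))
    have h2 : flagDims u s V i.succ ≤ flagDims u s V i.castSucc + (u (i + 1) - u i) :=
      finrank_inf_coordSubspace_le_add hlt.le (le_of_flag_top hu huk (by omega)) V
    omega
  · have h3 : u i - r ≤ flagDims u s V i := le_finrank_inf_coordSubspace (hmono i) hr hV
    have h4 := hleV i
    have h5 := hleu i
    rw [max_le_iff, le_min_iff]
    omega
  · rw [hc]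
    exact (sum_fin_ite_eq_sum_Icc s _ _ fun i => rfl).symm

theorem card_flagDims_eq (hu0 : u 0 = 0) (hu : ∀ i ≤ s, u i < u (i + 1))
    (huk : u (s + 1) = k) {r : ℕ} {c : ℚ} {v : Fin (s + 2) → ℕ}
    (hv : v ∈ admissible (Fintype.card F) k r s u c) :
    (Nat.card {V : Submodule F (Fin k → F) // flagDims u s V = v} : ℚ) =
      tupleTerm (Fintype.card F) s u v := by
  rw [admissible, Finset.mem_filter] at hv
  obtain ⟨-, hv0, hvk, hvd, hvb, -⟩ := hv
  -- Clamping the index extends the flag and the tuple to all of `ℕ`, constant from `s + 1` on, as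
  -- `card_subspaces_flag` requires.
  let idx : ℕ → Fin (s + 2) := fun i => ⟨min i (s + 1), by omega⟩
  have hidx : ∀ i : Fin (s + 2), idx i = i := fun i => Fin.ext (by dsimp only [idx]; omega)
  let U : ℕ → Submodule F (Fin k → F) := fun i => coordSubspace F k (u (idx i))
  have hUmono : Monotone U := fun i j hij =>
    coordSubspace_mono (le_of_flag hu (by dsimp only [idx]; omega) (by dsimp only [idx]; omega))
  have hrank : ∀ i, Module.finrank F (U i) = u (idx i) := fun i =>
    finrank_coordSubspace (le_of_flag_top hu huk (by dsimp only [idx]; omega))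
  have hU0 : U 0 = ⊥ := by
    change coordSubspace F k (u (min 0 (s + 1))) = ⊥
    rw [Nat.zero_min, hu0, coordSubspace_zero]
  have hUtop : U (s + 1) = ⊤ := by
    change coordSubspace F k (u (min (s + 1) (s + 1))) = ⊤
    rw [min_self, huk, coordSubspace_self]
  have hmono : ∀ i < s + 1, v (idx i) ≤ v (idx (i + 1)) := by
    intro i hi
    have h1 : idx i = (⟨i, hi⟩ : Fin (s + 1)).castSucc :=
      Fin.ext (by dsimp only [idx, Fin.castSucc_mk]; omega)
    have h2 : idx (i + 1) = (⟨i, hi⟩ : Fin (s + 1)).succ :=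
      Fin.ext (by dsimp only [idx, Fin.succ_mk]; omega)
    rcases Nat.lt_or_ge i s with h | h
    · have := (hvd ⟨i, hi⟩ h).1
      rw [h1, h2]
      omega
    -- Admissibility imposes no difference condition at the last step; there `v_s ≤ k - r = v_{s+1}`
    -- comes from the upper bound on `v_s`, or from `v_0 = 0` if `s = 0`.
    · obtain rfl : i = s := by omega
      have h3 : idx (i + 1) = Fin.last (i + 1) := h2
      rw [h3]
      rcases Nat.eq_zero_or_pos i with rfl | hpos
      · have : idx 0 = 0 := rfl
        rw [this, hv0]
        exact Nat.zero_le _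
      · have hval : ((idx i : Fin (i + 2)) : ℕ) = i := by dsimp only [idx]; omega
        have := (le_min_iff.1 (hvb (idx i) (by omega) (by omega)).2).2
        omega
  have key := card_subspaces_flag U hUmono hU0 (fun i => v (idx i)) hv0 (s + 1) hmono
  have hcongr : Nat.card {V : Submodule F (Fin k → F) // flagDims u s V = v} =
      Nat.card {V : Submodule F (Fin k → F) // V ≤ U (s + 1) ∧
        ∀ i ≤ s + 1, Module.finrank F ↥(V ⊓ U i) = v (idx i)} := by
    refine Nat.card_congr (Equiv.subtypeEquivRight fun V => ?_)
    rw [hUtop]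
    constructor
    · rintro rfl
      exact ⟨le_top, fun i _ => rfl⟩
    · rintro ⟨-, h⟩
      funext i
      have := h i (by omega)
      have hUi : U i = coordSubspace F k (u i) :=
        congrArg (fun a : Fin (s + 2) => coordSubspace F k (u a)) (hidx i)
      rwa [hidx i, hUi] at this
  rw [hcongr, key, tupleTerm, Finset.prod_range]
  refine Finset.prod_congr rfl fun i _ => ?_
  have h1 : idx (i : ℕ) = i.castSucc := hidx i.castSucc
  have h2 : idx ((i : ℕ) + 1) = i.succ := hidx i.succ
  rw [hrank, hrank, h1, h2]
  rfl

/-- The spaces `V` are sorted by their dimensions along the flag. The last entry fixes `dim V`, the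
sum condition fixes the number of columns outside `V`, and the remaining conditions hold
automatically for such dimensions. -/
theorem subcodeCount_punctured (hs : 1 ≤ s) (hst : s ≤ t)
    (hu0 : u 0 = 0) (hu : ∀ i ≤ s, u i < u (i + 1)) (huk : u (s + 1) = k)
    (hS : IsSimplexGenerator S) (hG : IsPuncturedCopies S u s t G) {r : ℕ} (hr : r ≤ k) (j : ℕ) :
    (subcodeCount (rowCode G) r j : ℚ) =
      ∑ v ∈ admissible (Fintype.card F) k r s u
          ((j : ℚ) - t * (((Fintype.card F : ℚ) ^ k - (Fintype.card F : ℚ) ^ (k - r)) /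
            ((Fintype.card F : ℚ) - 1)) +
          ∑ i ∈ Finset.Icc 1 s, ((Fintype.card F : ℚ) ^ u i - 1) / ((Fintype.card F : ℚ) - 1)),
        tupleTerm (Fintype.card F) s u v := by
  classical
  have hk := two_le_of_flag hs hu huk
  have huk' : ∀ i ≤ s, u i ≤ k := fun i hi => le_of_flag_top hu huk (by omega)
  have := Fintype.ofFinite (Submodule F (Fin k → F))
  rw [subcodeCount_rowCode (vecMulLinear_injective_punctured hs hst hu0 hu huk hS hG) hr,
    Nat.card_eq_fintype_card, Fintype.card_subtype, Finset.card_eq_sum_card_fiberwise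
      (f := flagDims u s) (t := admissible (Fintype.card F) k r s u _)]
  · rw [Nat.cast_sum]
    refine Finset.sum_congr rfl fun v hv => ?_
    rw [← card_flagDims_eq hu0 hu huk hv, Nat.card_eq_fintype_card, Fintype.card_subtype,
      Finset.filter_filter]
    congr 2
    ext V
    simp only [Finset.mem_filter, Finset.mem_univ, true_and, and_iff_right_iff_imp]
    rintro rfl
    rw [admissible, Finset.mem_filter] at hv
    obtain ⟨-, -, hvk, -, -, hc⟩ := hv
    have hV : Module.finrank F V = k - r := by
      rw [flagDims, Fin.val_last, huk, coordSubspace_self, inf_top_eq] at hvk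
      omega
    refine ⟨hV, (card_columns_punctured_notMem_eq_iff hk hS hst huk' hG hV j).2 ?_⟩
    rw [hc]
    exact sum_fin_ite_eq_sum_Icc s _ _ fun i => rfl
  · intro V hV
    obtain ⟨h1, h2⟩ := (Finset.mem_filter.1 hV).2
    exact flagDims_mem_admissible hu0 hu huk hr h1
      ((card_columns_punctured_notMem_eq_iff hk hS hst huk' hG h1 j).1 h2)

end SubcodeCount

end LinCode

/-! ### The theorem -/

theorem mainTheorem1 {F : Type*} [Field F] [Fintype F] [DecidableEq F]
    (q : ℕ) (hq : Fintype.card F = q)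
    (k s t : ℕ) (hs : 1 ≤ s) (hst : s ≤ t)
    (u : ℕ → ℕ) (hu0 : u 0 = 0) (hu : ∀ i ≤ s, u i < u (i + 1)) (huk : u (s + 1) = k) :
    -- the construction can be carried out
    (∃ (m n : ℕ) (S : Matrix (Fin k) (Fin m) F) (G : Matrix (Fin k) (Fin n) F),
      LinCode.IsSimplexGenerator S ∧ LinCode.IsPuncturedCopies S u s t G) ∧
    -- and every code it yields has the stated properties
    ∀ (m n : ℕ) (S : Matrix (Fin k) (Fin m) F) (G : Matrix (Fin k) (Fin n) F)
      (C : Submodule F (Fin n → F)),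
      LinCode.IsSimplexGenerator S → LinCode.IsPuncturedCopies S u s t G →
      C = LinCode.rowCode G →
      -- parameters `[n, k, d]`
      ((n : ℚ) = t * (((q : ℚ) ^ k - 1) / ((q : ℚ) - 1)) -
          ∑ i ∈ Finset.Icc 1 s, ((q : ℚ) ^ u i - 1) / ((q : ℚ) - 1)) ∧
      Module.finrank F C = k ∧
      ((LinCode.minDist C : ℤ) = t * (q : ℤ) ^ (k - 1) -
          ∑ i ∈ Finset.Icc 1 s, (q : ℤ) ^ (u i - 1)) ∧
      -- weight distribution
      (LinCode.weightCount C 0 = 1 ∧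
        (∀ j ≤ s,
          (LinCode.weightCount C
            (LinCode.minDist C + ∑ i ∈ Finset.Icc 1 j, q ^ (u i - 1)) : ℤ) =
            (q : ℤ) ^ (k - u j) - (q : ℤ) ^ (k - u (j + 1))) ∧
        (∀ w : ℕ, w ≠ 0 →
          (∀ j ≤ s, w ≠ LinCode.minDist C + ∑ i ∈ Finset.Icc 1 j, q ^ (u i - 1)) →
          LinCode.weightCount C w = 0) ∧
        {w : ℕ | 1 ≤ w ∧ LinCode.weightCount C w ≠ 0}.ncard = s + 1) ∧
      -- Griesmer code
      LinCode.IsGriesmer C ∧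
      -- generalized Hamming weights
      (∀ r : ℕ, 1 ≤ r → r ≤ k →
        (LinCode.ghw C r : ℚ) =
          t * (((q : ℚ) ^ k - (q : ℚ) ^ (k - r)) / ((q : ℚ) - 1)) -
            ∑ i ∈ Finset.Icc 1 s, ((q : ℚ) ^ u i - 1) / ((q : ℚ) - 1) +
            ∑ i ∈ Finset.Icc (Nat.findGreatest (fun i => u i ≤ r) s + 1) s,
              ((q : ℚ) ^ (u i - r) - 1) / ((q : ℚ) - 1)) ∧
      -- subcode support weight distributions
      (∀ r : ℕ, 1 ≤ r → r ≤ k → ∀ j : ℕ, 1 ≤ j → j ≤ n →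
        (LinCode.subcodeCount C r j : ℚ) =
          ∑ v ∈ LinCode.admissible q k r s u
              ((j : ℚ) - t * (((q : ℚ) ^ k - (q : ℚ) ^ (k - r)) / ((q : ℚ) - 1)) +
                ∑ i ∈ Finset.Icc 1 s, ((q : ℚ) ^ u i - 1) / ((q : ℚ) - 1)),
            LinCode.tupleTerm q s u v) := by
  subst hq
  have hq2 : 2 ≤ Fintype.card F := Fintype.one_lt_card
  have hq0 := (LinCode.card_sub_one_pos F).ne'
  have hk := LinCode.two_le_of_flag hs hu huk
  have hle : ∀ i ≤ s, u i ≤ k := fun i hi => LinCode.le_of_flag_top hu huk (by omega)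
  refine ⟨?_, ?_⟩
  · obtain ⟨m, S, hS⟩ := LinCode.exists_isSimplexGenerator F k
    obtain ⟨n, G, hG⟩ := LinCode.exists_isPuncturedCopies S u s t
    exact ⟨m, n, S, G, hS, hG⟩
  rintro m n S G C hS hG rfl
  obtain ⟨d, hd0, hd⟩ := LinCode.exists_designed_distance hst hs hu huk hq2
  have hinj := LinCode.vecMulLinear_injective_punctured hs hst hu0 hu huk hS hG
  rw [LinCode.minDist_punctured hs hst hu0 hu huk hS hG hd0 hd]
  refine ⟨?_, LinCode.finrank_rowCode hinj, ?_, ⟨LinCode.weightCount_zero _, fun j hj =>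
    LinCode.weightCount_punctured hs hst hu0 hu huk hS hG hd0 hd hj, fun w =>
    LinCode.weightCount_punctured_eq_zero hs hst hu0 hu huk hS hG hd,
    LinCode.ncard_weights_punctured hs hst hu0 hu huk hS hG hd0 hd⟩,
    LinCode.isGriesmer_punctured hs hst hu0 hu huk hS hG, fun r _ hr => ?_, fun r _ hr j _ _ =>
    LinCode.subcodeCount_punctured hs hst hu0 hu huk hS hG hr j⟩
  · rw [eq_div_of_mul_eq hq0 (LinCode.length_punctured hk hS hst hle hG), ← Finset.sum_div]
    ring
  · have hd' : (d : ℤ) + ∑ i ∈ Finset.Icc 1 s, (Fintype.card F : ℤ) ^ (u i - 1) =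
        t * (Fintype.card F : ℤ) ^ (k - 1) := by exact_mod_cast hd
    linarith
  -- For `u i ≤ r` the truncated exponent `u i - r` is `0` and the term vanishes, so the sum may
  -- start at `1`. The default index `0` of `Nat.findGreatest` is legitimate since `u 0 = 0 ≤ r`.
  · have htail : ∑ i ∈ Finset.Icc (Nat.findGreatest (fun i => u i ≤ r) s + 1) s,
        ((Fintype.card F : ℚ) ^ (u i - r) - 1) / ((Fintype.card F : ℚ) - 1) =
        ∑ i ∈ Finset.Icc 1 s,
          ((Fintype.card F : ℚ) ^ (u i - r) - 1) / ((Fintype.card F : ℚ) - 1) := by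
      refine Finset.sum_subset (Finset.Icc_subset_Icc_left (by omega)) fun i hi hi' => ?_
      rw [Finset.mem_Icc] at hi hi'
      have h1 : u (Nat.findGreatest (fun i => u i ≤ r) s) ≤ r :=
        Nat.findGreatest_spec (P := fun i => u i ≤ r) (Nat.zero_le s) (by omega)
      have h2 := Nat.findGreatest_le (P := fun i => u i ≤ r) s
      have h3 : u i ≤ u (Nat.findGreatest (fun i => u i ≤ r) s) :=
        LinCode.le_of_flag hu (by omega) (by omega)
      rw [Nat.sub_eq_zero_of_le (h3.trans h1), pow_zero, sub_self, zero_div]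
    rw [htail, eq_div_of_mul_eq hq0 (LinCode.ghw_punctured hs hst hu0 hu huk hS hG hr),
      ← Finset.sum_div, ← Finset.sum_div, Finset.sum_sub_distrib, Finset.sum_sub_distrib,
      Finset.sum_sub_distrib]
    ring
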